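/- Let $n\ge 1$ and let $\Omega\subset\mathbb{R}^n$ be a domain, i.e. a nonempty connected open set, possibly unbounded, with $C^2$ boundary (in particular, any smooth domain), such that $$\limsup_{R\to+\infty}\frac{|\Omega\cap\{|x|\le R\}|}{R^2}<+\infty .$$ Let $\nu$ be the outward unit normal on $\partial\Omega$, let $f\in C^1(\mathbb{R})$, and let $u\in C^2(\overline\Omega)\cap L^\infty(\Omega)$ be a stable solution of $-\Delta u=f(u)$ in $\Omega$, $\partial_\nu u=0$ on $\partial\Omega$; that is, a solution for which $$\lambda_1:=\inf\Big\{\int_\Omega |\nabla\psi|^2-f'(u)\psi^2\;:\;\psi\in H^1(\Omega),\ \|\psi\|_{L^2(\Omega)}=1\Big\}\ge 0 .$$ Let $\varphi$ be a principal eigenfunction associated with $\lambda_1$, i.e. $\varphi\in C^2(\overline\Omega)$, $\varphi>0$ on $\overline\Omega$, $-\Delta\varphi-f'(u)\varphi=\lambda_1\varphi$ in $\Omega$ and $\partial_\nu\varphi=0$ on $\partial\Omega$. Let $\chi:[0,\infty)\to[0,\infty)$ be smooth with $\chi=1$ on $[0,1]$, $\chi=0$ on $[2,\infty)$ and $|\chi'|\le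 2$, and put $\chi_R(x):=\chi(|x|/R)$. Let $v\in C^2(\overline\Omega)$ be bounded and satisfy $$v\,(\Delta v+f'(u)v)\ge 0\ \text{ in }\Omega,\qquad \int_{\partial\Omega}\chi_R^2\,\partial_\nu (v^2)\le 0\ \text{ for all } R>1 .$$ Then there is a constant $C\in\mathbb{R}$ such that $v=C\varphi$ on $\overline\Omega$. -/

import Mathlib

open MeasureTheory Filter Topology
open scoped ContDiff

noncomputable section

/-- `ρ` is a local defining function of class `C²` for `Ω` on the open neighbourhood `U` of `x`:
`∇ρ` does not vanish on `U`, and inside `U` the set `Ω` is exactly `{ρ < 0}`. -/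
structure IsLocalDefiningFunction {n : ℕ} (Ω : Set (EuclideanSpace ℝ (Fin n)))
    (x : EuclideanSpace ℝ (Fin n)) (U : Set (EuclideanSpace ℝ (Fin n)))
    (ρ : EuclideanSpace ℝ (Fin n) → ℝ) : Prop where
  isOpen : IsOpen U
  mem : x ∈ U
  contDiffOn : ContDiffOn ℝ 2 ρ U
  gradient_ne_zero : ∀ y ∈ U, gradient ρ y ≠ 0
  inter_eq : Ω ∩ U = {y ∈ U | ρ y < 0}

/-- A (possibly unbounded) domain of `ℝⁿ`: a nonempty connected open set whose boundary is of
class `C²`, with `Ω` lying locally on one side of it. -/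
structure IsRegularDomain {n : ℕ} (Ω : Set (EuclideanSpace ℝ (Fin n))) : Prop where
  isOpen : IsOpen Ω
  isConnected : IsConnected Ω
  exists_definingFunction : ∀ x ∈ frontier Ω, ∃ U ρ, IsLocalDefiningFunction Ω x U ρ

/-- `ν` is the outward unit normal to `∂Ω` at `x`, that is `ν = ∇ρ(x) / |∇ρ(x)|` for a local
defining function `ρ`. -/
def IsOutwardUnitNormal {n : ℕ} (Ω : Set (EuclideanSpace ℝ (Fin n)))
    (x ν : EuclideanSpace ℝ (Fin n)) : Prop :=
  ∃ U ρ, IsLocalDefiningFunction Ω x U ρ ∧ ν = ‖gradient ρ x‖⁻¹ • gradient ρ x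

open Classical in
/-- The outward unit normal field of `∂Ω` (with value `0` where there is no normal). -/
def outwardNormal {n : ℕ} (Ω : Set (EuclideanSpace ℝ (Fin n)))
    (x : EuclideanSpace ℝ (Fin n)) : EuclideanSpace ℝ (Fin n) :=
  if h : ∃ ν, IsOutwardUnitNormal Ω x ν then h.choose else 0

theorem IsRegularDomain.isOutwardUnitNormal_outwardNormal {n : ℕ}
    {Ω : Set (EuclideanSpace ℝ (Fin n))} (hΩ : IsRegularDomain Ω)
    {x : EuclideanSpace ℝ (Fin n)} (hx : x ∈ frontier Ω) :
    IsOutwardUnitNormal Ω x (outwardNormal Ω x) := by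
  have h : ∃ ν, IsOutwardUnitNormal Ω x ν := by
    obtain ⟨U, ρ, h⟩ := hΩ.exists_definingFunction x hx
    exact ⟨_, U, ρ, h, rfl⟩
  rw [outwardNormal, dif_pos h]
  exact h.choose_spec

/-- `w ∈ C²(Ω̄)`: the function is twice continuously differentiable up to the boundary. Only the
values of `w` on `closure Ω` matter. -/
def IsC2Closure {n : ℕ} (Ω : Set (EuclideanSpace ℝ (Fin n)))
    (w : EuclideanSpace ℝ (Fin n) → ℝ) : Prop :=
  ContDiffOn ℝ 2 w (closure Ω)

/-- `w` is bounded on `Ω`. -/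
def IsBoundedOn {n : ℕ} (Ω : Set (EuclideanSpace ℝ (Fin n)))
    (w : EuclideanSpace ℝ (Fin n) → ℝ) : Prop :=
  ∃ M : ℝ, ∀ x ∈ Ω, |w x| ≤ M

/-- The outward normal derivative `∂_ν w` at the boundary point `x`, for `w` defined on `Ω̄`. -/
def normalDeriv {n : ℕ} (Ω : Set (EuclideanSpace ℝ (Fin n)))
    (w : EuclideanSpace ℝ (Fin n) → ℝ) (x : EuclideanSpace ℝ (Fin n)) : ℝ :=
  fderivWithin ℝ w (closure Ω) x (outwardNormal Ω x)

/-- `u` is a (classical, bounded) solution of `-Δu = f(u)` in `Ω`, `∂_ν u = 0` on `∂Ω`. -/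
structure IsNeumannSolution {n : ℕ} (Ω : Set (EuclideanSpace ℝ (Fin n))) (f : ℝ → ℝ)
    (u : EuclideanSpace ℝ (Fin n) → ℝ) : Prop where
  isC2Closure : IsC2Closure Ω u
  isBoundedOn : IsBoundedOn Ω u
  equation : ∀ x ∈ Ω, -(Laplacian.laplacian u x) = f (u x)
  neumann : ∀ x ∈ frontier Ω, normalDeriv Ω u x = 0

/-- `G` is the weak gradient of `ψ` on `Ω`, tested against `C_c^∞(Ω)`. -/
def IsWeakGradient {n : ℕ} (Ω : Set (EuclideanSpace ℝ (Fin n)))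
    (ψ : EuclideanSpace ℝ (Fin n) → ℝ)
    (G : EuclideanSpace ℝ (Fin n) → EuclideanSpace ℝ (Fin n)) : Prop :=
  ∀ η : EuclideanSpace ℝ (Fin n) → ℝ, ContDiff ℝ ∞ η → HasCompactSupport η → tsupport η ⊆ Ω →
    ∀ e : EuclideanSpace ℝ (Fin n),
      ∫ x in Ω, ψ x * fderiv ℝ η x e = -∫ x in Ω, inner ℝ (G x) e * η x

/-- `ψ ∈ H¹(Ω)`, with weak gradient `G`. -/
structure IsH1 {n : ℕ} (Ω : Set (EuclideanSpace ℝ (Fin n)))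
    (ψ : EuclideanSpace ℝ (Fin n) → ℝ)
    (G : EuclideanSpace ℝ (Fin n) → EuclideanSpace ℝ (Fin n)) : Prop where
  memLp : MemLp ψ 2 (volume.restrict Ω)
  memLp_gradient : MemLp G 2 (volume.restrict Ω)
  isWeakGradient : IsWeakGradient Ω ψ G

/-- The generalized principal eigenvalue
`λ₁ = inf {∫_Ω |∇ψ|² - f'(u) ψ² : ψ ∈ H¹(Ω), ‖ψ‖_{L²(Ω)} = 1}`. -/
def principalEigenvalue {n : ℕ} (Ω : Set (EuclideanSpace ℝ (Fin n))) (f : ℝ → ℝ)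
    (u : EuclideanSpace ℝ (Fin n) → ℝ) : ℝ :=
  sInf {s : ℝ | ∃ ψ G, IsH1 Ω ψ G ∧ (∫ x in Ω, (ψ x) ^ 2) = 1 ∧
    s = ∫ x in Ω, (‖G x‖ ^ 2 - deriv f (u x) * (ψ x) ^ 2)}

/-- A stable solution: a solution with `λ₁ ≥ 0`. -/
structure IsStableSolution {n : ℕ} (Ω : Set (EuclideanSpace ℝ (Fin n))) (f : ℝ → ℝ)
    (u : EuclideanSpace ℝ (Fin n) → ℝ) : Prop where
  isNeumannSolution : IsNeumannSolution Ω f u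
  stable : 0 ≤ principalEigenvalue Ω f u

/-- A principal eigenfunction associated with `λ₁`: a function `φ ∈ C²(Ω̄)`, positive on `Ω̄`, with
`-Δφ - f'(u) φ = λ₁ φ` in `Ω` and `∂_ν φ = 0` on `∂Ω`. It need not belong to `H¹(Ω)`. -/
structure IsPrincipalEigenfunction {n : ℕ} (Ω : Set (EuclideanSpace ℝ (Fin n))) (f : ℝ → ℝ)
    (u φ : EuclideanSpace ℝ (Fin n) → ℝ) : Prop where
  isC2Closure : IsC2Closure Ω φ
  pos : ∀ x ∈ closure Ω, 0 < φ x
  equation : ∀ x ∈ Ω,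
    -(Laplacian.laplacian φ x) - deriv f (u x) * φ x = principalEigenvalue Ω f u * φ x
  neumann : ∀ x ∈ frontier Ω, normalDeriv Ω φ x = 0

/-- The growth condition `limsup_{R → +∞} |Ω ∩ {|x| ≤ R}| / R² < +∞`. -/
def HasQuadraticGrowth {n : ℕ} (Ω : Set (EuclideanSpace ℝ (Fin n))) : Prop :=
  limsup (fun R : ℝ => volume (Ω ∩ {x | ‖x‖ ≤ R}) / ENNReal.ofReal (R ^ 2)) atTop < ⊤

/-- A cut-off profile on `[0, ∞)`: smooth, nonnegative, equal to `1` on `[0, 1]` and to `0` on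
`[2, ∞)`, with `|χ'| ≤ 2`. The values at negative arguments are never used. -/
structure IsCutoffProfile (χ : ℝ → ℝ) : Prop where
  contDiff : ContDiff ℝ ∞ χ
  nonneg : ∀ z, 0 ≤ z → 0 ≤ χ z
  eq_one : ∀ z, 0 ≤ z → z ≤ 1 → χ z = 1
  eq_zero : ∀ z, 2 ≤ z → χ z = 0
  abs_deriv_le : ∀ z, 0 ≤ z → |deriv χ z| ≤ 2

/-- The cut-off function `χ_R(x) = χ(|x| / R)`. -/
def cutoff {n : ℕ} (χ : ℝ → ℝ) (R : ℝ) (x : EuclideanSpace ℝ (Fin n)) : ℝ :=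
  χ (‖x‖ / R)

/-- The surface integral `∫_{∂Ω} g`, with respect to the `(n-1)`-dimensional Hausdorff measure
(normalized so as to be the usual surface measure), for `n ≥ 1`. -/
def surfaceIntegral {n : ℕ} (Ω : Set (EuclideanSpace ℝ (Fin n)))
    (g : EuclideanSpace ℝ (Fin n) → ℝ) : ℝ :=
  ∫ x in frontier Ω, g x ∂(Measure.euclideanHausdorffMeasure (n - 1))

end

/-! Put `Z = ∇v - (v/φ)∇φ`, that is `φ ∇(v/φ)`. For a cut-off `c`, the divergence of `c² v Z` is `2
c v ∇c·Z + c² (|Z|² + v Δv - (v²/φ) Δφ)`. The equation for `φ` turns `v Δv - (v²/φ) Δφ` into `v (Δv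
+ f'(u) v) + λ₁ v²`, which is nonnegative by the assumption on `v` and by stability. Since `∂_ν φ =
0`, the boundary flux is `c² v ∂_ν v = ½ c² ∂_ν (v²)`, whose integral is nonpositive for `c = χ_R`.
Hence `∫ c² |Z|² ≤ -2 ∫ c v ∇c·Z`, and `∇c` lives on `R ≤ |x| ≤ 2R` with size `O(1/R)`.

Young's inequality with a free weight `t` bounds the right side by `t` times the energy outside the
ball of radius `R`, plus `t⁻¹ (2M/R)² |Ω ∩ {|x| ≤ 2R}|`. Quadratic growth keeps the last term below
`K/t` (`IsRegularDomain.integral_cutoff_sq_mul_le`). Taking `t = 1/2` shows `|Z|²` integrable; then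
the tail energy tends to `0`, and `R → ∞` followed by `t → ∞` gives `∫ |Z|² = 0`
(`integral_eq_zero_of_cutoff_estimate`). So `v/φ` has zero gradient on a connected set.

The analytic input is the divergence theorem with Hausdorff surface measure,
`IsRegularDomain.setIntegral_fderiv_eq`. Near a boundary point, `Ω` lies below a graph with small
Lipschitz constant, and the fundamental theorem of calculus along the normal axis gives an integral
over the base. Base and surface measure agree up to a factor close to `1`, so the theorem first
holds with an error `δ ∫ |φ|` (`IsRegularDomain.exists_isAlmostDivergence`). These errors add up
without loss under a partition of unity (`IsAlmostDivergence.union`), and then `δ → 0`. -/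

section Calculus

/-! ### Compactly supported functions on a closed domain, and exchange of derivatives tangential to
a level set. -/

variable {E : Type*} [NormedAddCommGroup E] [NormedSpace ℝ E]

theorem ContDiffOn.mul_of_tsupport_subset {s U : Set E} {φ h : E → ℝ} {m : WithTop ℕ∞}
    (hφ : ContDiffOn ℝ m φ s) (hU : IsOpen U) (hh : ContDiffOn ℝ m h U) (hsub : tsupport φ ⊆ U) :
    ContDiffOn ℝ m (fun x => φ x * h x) s := by
  intro x hx
  by_cases hxU : x ∈ U
  · exact (hφ x hx).mul ((hh x hxU).contDiffAt (hU.mem_nhds hxU)).contDiffWithinAt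
  · have h0 : φ =ᶠ[𝓝 x] 0 := notMem_tsupport_iff_eventuallyEq.1 fun h => hxU (hsub h)
    have h1 : (fun x => φ x * h x) =ᶠ[𝓝 x] fun _ => 0 := by
      filter_upwards [h0] with y hy
      simp [hy]
    exact (contDiffAt_const.congr_of_eventuallyEq h1).contDiffWithinAt

theorem fderiv_eq_zero_of_notMem_tsupport {F : Type*} [NormedAddCommGroup F] [NormedSpace ℝ F]
    {φ : E → F} {x : E} (hx : x ∉ tsupport φ) :
    fderiv ℝ φ x = 0 := by
  have := (notMem_tsupport_iff_eventuallyEq.1 hx).fderiv_eq (𝕜 := ℝ)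
  rw [this]
  simp

theorem fderivWithin_closure_eq_fderiv {F : Type*} [NormedAddCommGroup F] [NormedSpace ℝ F]
    {Ω : Set E} (hΩ : IsOpen Ω) (φ : E → F) {x : E}
    (hx : x ∈ Ω) : fderivWithin ℝ φ (closure Ω) x = fderiv ℝ φ x :=
  fderivWithin_of_mem_nhds (mem_of_superset (hΩ.mem_nhds hx) subset_closure)

variable [MeasurableSpace E] [BorelSpace E]

omit [NormedSpace ℝ E] in
theorem ContinuousOn.integrableOn_of_hasCompactSupport {s t : Set E} {φ : E → ℝ} {μ : Measure E}
    (hs : IsClosed s) (ht : MeasurableSet t) (hts : t ⊆ s) (hφ : ContinuousOn φ s)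
    (hc : HasCompactSupport φ) (hμ : μ (tsupport φ ∩ s) ≠ ⊤) : IntegrableOn φ t μ := by
  have h1 : IntegrableOn φ (tsupport φ ∩ s) μ :=
    (hφ.mono Set.inter_subset_right).integrableOn_of_subset_isCompact
      (hc.isCompact.inter_right hs) (hc.isCompact.inter_right hs).measurableSet subset_rfl hμ
  have h2 : IntegrableOn φ (tsupport φ ∩ t) μ :=
    h1.mono_set (Set.inter_subset_inter_right _ hts)
  exact h2.of_forall_sdiff_eq_zero ht fun x hx => by
    by_contra h
    exact hx.2 ⟨subset_tsupport _ h, hx.1⟩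

/-- Inside `Ω` the derivative coincides with `fderivWithin` on the closure. The latter is continuous
up to the boundary, hence integrable on the compact part of the closure that meets the support. -/
theorem integrableOn_fderiv_of_contDiffOn_closure {Ω : Set E} {μ : Measure E}
    [IsFiniteMeasureOnCompacts μ]
    (hΩ : IsOpen Ω) (hd : UniqueDiffOn ℝ (closure Ω)) {φ : E → ℝ}
    (hφ : ContDiffOn ℝ 1 φ (closure Ω)) (hc : HasCompactSupport φ) (e : E) :
    IntegrableOn (fun x => fderiv ℝ φ x e) Ω μ := by
  have h1 : ContinuousOn (fun x => fderivWithin ℝ φ (closure Ω) x e) (closure Ω) :=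
    (hφ.continuousOn_fderivWithin hd le_rfl).clm_apply continuousOn_const
  have h2 : IntegrableOn (fun x => fderivWithin ℝ φ (closure Ω) x e) (tsupport φ ∩ closure Ω) μ :=
    (h1.mono Set.inter_subset_right).integrableOn_compact (hc.isCompact.inter_right isClosed_closure)
  have h3 : IntegrableOn (fun x => fderivWithin ℝ φ (closure Ω) x e) (tsupport φ ∩ Ω) μ :=
    h2.mono_set (Set.inter_subset_inter_right _ subset_closure)
  have h4 : IntegrableOn (fun x => fderiv ℝ φ x e) (tsupport φ ∩ Ω) μ :=
    h3.congr_fun (fun x hx => by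
      simp only [fderivWithin_closure_eq_fderiv hΩ φ hx.2])
      ((isClosed_tsupport _).measurableSet.inter hΩ.measurableSet)
  refine h4.of_forall_sdiff_eq_zero hΩ.measurableSet fun x hx => ?_
  rw [fderiv_eq_zero_of_notMem_tsupport fun h => hx.2 ⟨h, hx.1⟩]
  rfl

variable [FiniteDimensional ℝ E]

theorem integral_fderiv_eq_zero_of_hasCompactSupport {μ : Measure E} [μ.IsAddHaarMeasure]
    {φ : E → ℝ} (hφ : ContDiff ℝ 1 φ)
    (hc : HasCompactSupport φ) (e : E) : ∫ x, fderiv ℝ φ x e ∂μ = 0 := by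
  have h1 : Integrable (fun x => fderiv ℝ φ x e) μ :=
    ((hφ.continuous_fderiv one_ne_zero).clm_apply continuous_const).integrable_of_hasCompactSupport
      (hc.fderiv_apply ℝ e)
  have := integral_mul_fderiv_eq_neg_fderiv_mul_of_integrable (μ := μ) (f := fun _ : E => (1 : ℝ))
    (g := φ) (v := e) (by simp) (by simpa using h1)
    (by simpa using hφ.continuous.integrable_of_hasCompactSupport hc)
    (fun x _ => differentiableAt_const _) (fun x _ => (hφ.differentiable one_ne_zero) x)
  simpa using this

/-- A smooth step function: `0` on `[-1, ∞)`, `1` on `(-∞, -2]`. -/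
noncomputable def stepDown (s : ℝ) : ℝ := Real.smoothTransition (-s - 1)

theorem contDiff_stepDown : ContDiff ℝ 1 stepDown :=
  Real.smoothTransition.contDiff.comp (by fun_prop)

theorem stepDown_eq_zero {s : ℝ} (h : -1 ≤ s) : stepDown s = 0 :=
  Real.smoothTransition.zero_of_nonpos (by linarith)

theorem stepDown_eq_one {s : ℝ} (h : s ≤ -2) : stepDown s = 1 :=
  Real.smoothTransition.one_of_one_le (by linarith)

theorem abs_stepDown_le_one (s : ℝ) : |stepDown s| ≤ 1 := by
  rw [stepDown, abs_of_nonneg (Real.smoothTransition.nonneg _)]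
  exact Real.smoothTransition.le_one _

-- At a point of `U` outside `Ω` one has `k ρ ≥ 0 > -1`, and this strict inequality persists nearby,
-- where the step is `0`. The truncation therefore vanishes in a neighbourhood of the boundary and
-- extends by zero without loss of regularity.
omit [NormedSpace ℝ E] [MeasurableSpace E] [BorelSpace E] [FiniteDimensional ℝ E] in
theorem indicator_stepDown_mul_eventuallyEq_zero {Ω U : Set E} {ρ ψ : E → ℝ}
    (hU : IsOpen U) (hρ : ContinuousOn ρ U) (hdef : ∀ x ∈ U, x ∈ Ω ↔ ρ x < 0)
    (hsub : tsupport ψ ⊆ U) {k : ℝ} (hk : 0 ≤ k) {x : E} (hx : x ∉ Ω) :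
    (Ω.indicator fun x => ψ x * stepDown (k * ρ x)) =ᶠ[𝓝 x] fun _ => 0 := by
  by_cases hxU : x ∈ U
  swap
  · have h0 : ψ =ᶠ[𝓝 x] 0 := notMem_tsupport_iff_eventuallyEq.1 fun h => hxU (hsub h)
    filter_upwards [h0] with y hy
    simp [hy]
  · have h2 : 0 ≤ ρ x := not_lt.1 fun h => hx ((hdef x hxU).2 h)
    have h4 : ContinuousAt (fun y => k * ρ y) x :=
      continuousAt_const.mul (hρ.continuousAt (hU.mem_nhds hxU))
    have h3 : ∀ᶠ y in 𝓝 x, -1 < k * ρ y :=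
      h4.eventually_const_lt (by have := mul_nonneg hk h2; linarith)
    filter_upwards [h3] with y hy
    simp [stepDown_eq_zero hy.le]

omit [MeasurableSpace E] [BorelSpace E] [FiniteDimensional ℝ E] in
theorem contDiff_indicator_stepDown_mul {Ω U : Set E} {ρ ψ : E → ℝ} (hΩ : IsOpen Ω)
    (hU : IsOpen U) (hρ : ContDiffOn ℝ 1 ρ U) (hdef : ∀ x ∈ U, x ∈ Ω ↔ ρ x < 0)
    (hψ : ContDiffOn ℝ 1 ψ (closure Ω)) (hsub : tsupport ψ ⊆ U) {k : ℝ} (hk : 0 ≤ k) :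
    ContDiff ℝ 1 (Ω.indicator fun x => ψ x * stepDown (k * ρ x)) := by
  rw [contDiff_iff_contDiffAt]
  intro x
  by_cases hxΩ : x ∈ Ω
  swap
  · exact contDiffAt_const.congr_of_eventuallyEq
      (indicator_stepDown_mul_eventuallyEq_zero hU hρ.continuousOn hdef hsub hk hxΩ)
  have h2 : ContDiffOn ℝ 1 (fun x => ψ x * stepDown (k * ρ x)) (closure Ω) :=
    hψ.mul_of_tsupport_subset hU
      (contDiff_stepDown.comp_contDiffOn (contDiffOn_const.mul hρ)) hsub
  refine ((h2 x (subset_closure hxΩ)).contDiffAt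
    (mem_of_superset (hΩ.mem_nhds hxΩ) subset_closure)).congr_of_eventuallyEq ?_
  filter_upwards [hΩ.mem_nhds hxΩ] with y hy
  rw [Set.indicator_of_mem hy]

/-- Integrating a tangential divergence: `∫_Ω ∂_e (φ ∂_{e'} ρ) = ∫_Ω ∂_{e'} (φ ∂_e ρ)` when
`Ω = {ρ < 0}` near the support of `φ`. -/
theorem setIntegral_fderiv_mul_fderiv_comm {μ : Measure E} [μ.IsAddHaarMeasure]
    {Ω U : Set E} {ρ φ : E → ℝ} (hΩ : IsOpen Ω) (hd : UniqueDiffOn ℝ (closure Ω))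
    (hU : IsOpen U) (hρ : ContDiffOn ℝ 2 ρ U) (hdef : ∀ x ∈ U, x ∈ Ω ↔ ρ x < 0)
    (hφ : ContDiffOn ℝ 1 φ (closure Ω)) (hc : HasCompactSupport φ) (hsub : tsupport φ ⊆ U)
    (e e' : E) :
    ∫ x in Ω, fderiv ℝ (fun y => φ y * fderiv ℝ ρ y e') x e ∂μ =
      ∫ x in Ω, fderiv ℝ (fun y => φ y * fderiv ℝ ρ y e) x e' ∂μ := by
  have hρ1 : ContDiffOn ℝ 1 ρ U := hρ.of_le one_le_two
  have hdρ : ∀ w : E, ContDiffOn ℝ 1 (fun y => fderiv ℝ ρ y w) U := fun w =>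
    (hρ.fderiv_of_isOpen hU (by norm_num)).clm_apply contDiffOn_const
  have hψ : ∀ w : E, ContDiffOn ℝ 1 (fun y => φ y * fderiv ℝ ρ y w) (closure Ω) := fun w =>
    hφ.mul_of_tsupport_subset hU (hdρ w) hsub
  have hsub' : ∀ w : E, tsupport (fun y => φ y * fderiv ℝ ρ y w) ⊆ tsupport φ := fun w =>
    tsupport_mul_subset_left
  have hcψ : ∀ w : E, HasCompactSupport (fun y => φ y * fderiv ℝ ρ y w) := fun w => hc.mul_right
  have hint : ∀ w w' : E, IntegrableOn
      (fun x => fderiv ℝ (fun y => φ y * fderiv ℝ ρ y w) x w') Ω μ := fun w w' =>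
    integrableOn_fderiv_of_contDiffOn_closure hΩ hd (hψ w) (hcψ w) w'
  -- Truncating with a function of `kρ` gives `C¹` compactly supported functions on the whole space,
  -- whose derivatives integrate to zero.
  set F : ℕ → E → E → ℝ := fun k w =>
    Ω.indicator fun x => (φ x * fderiv ℝ ρ x w) * stepDown (k * ρ x) with hF
  have hF1 : ∀ k w, ContDiff ℝ 1 (F k w) := fun k w =>
    contDiff_indicator_stepDown_mul hΩ hU hρ1 hdef (hψ w) ((hsub' w).trans hsub) k.cast_nonneg
  have hFc : ∀ k w, HasCompactSupport (F k w) := fun k w => by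
    refine HasCompactSupport.intro hc.isCompact fun x hx => Set.indicator_apply_eq_zero.2 fun _ => ?_
    rw [image_eq_zero_of_notMem_tsupport hx]
    ring
  have hFi : ∀ k w w', Integrable (fun x => fderiv ℝ (F k w) x w') μ := fun k w w' =>
    (((hF1 k w).continuous_fderiv one_ne_zero).clm_apply
      continuous_const).integrable_of_hasCompactSupport ((hFc k w).fderiv_apply ℝ w')
  have hzero : ∀ k w w', ∫ x in Ω, fderiv ℝ (F k w) x w' ∂μ = 0 := by
    intro k w w'
    rw [setIntegral_eq_integral_of_forall_compl_eq_zero]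
    · exact integral_fderiv_eq_zero_of_hasCompactSupport (hF1 k w) (hFc k w) w'
    · intro x hx
      rw [(indicator_stepDown_mul_eventuallyEq_zero hU hρ1.continuousOn hdef
        ((hsub' w).trans hsub) k.cast_nonneg hx).fderiv_eq]
      simp
  set D : E → ℝ := fun x => fderiv ℝ (fun y => φ y * fderiv ℝ ρ y e') x e -
        fderiv ℝ (fun y => φ y * fderiv ℝ ρ y e) x e' with hD
  -- The derivative of the step contributes `k s'(kρ) φ (∂_{e'}ρ ∂_eρ - ∂_eρ ∂_{e'}ρ) = 0`, where
  -- `s` is the step. This cancellation is why no boundary layer survives as `k → ∞`.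
  have hpt : ∀ (k : ℕ), ∀ x ∈ Ω, fderiv ℝ (F k e') x e - fderiv ℝ (F k e) x e' =
      stepDown (k * ρ x) * D x := by
    intro k x hx
    have hloc : ∀ w, F k w =ᶠ[𝓝 x] fun x => (φ x * fderiv ℝ ρ x w) * stepDown (k * ρ x) := by
      intro w
      filter_upwards [hΩ.mem_nhds hx] with y hy
      simp only [hF, Set.indicator_of_mem hy]
    rw [(hloc e).fderiv_eq, (hloc e').fderiv_eq, hD]
    by_cases hxφ : x ∈ tsupport φ
    · have hxU := hsub hxφ
      have hdψ : ∀ w, DifferentiableAt ℝ (fun y => φ y * fderiv ℝ ρ y w) x := fun w =>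
        ((hψ w x (subset_closure hx)).contDiffAt
          (mem_of_superset (hΩ.mem_nhds hx) subset_closure)).differentiableAt one_ne_zero
      have hρd : DifferentiableAt ℝ ρ x :=
        ((hρ1 x hxU).contDiffAt (hU.mem_nhds hxU)).differentiableAt one_ne_zero
      have hst := ((contDiff_stepDown.differentiable one_ne_zero (k * ρ x)).hasDerivAt.comp_hasFDerivAt
        x (hρd.hasFDerivAt.const_mul (k : ℝ)))
      have hm : ∀ w, fderiv ℝ (fun x => (φ x * fderiv ℝ ρ x w) * stepDown (k * ρ x)) x = _ :=
        fun w => ((hdψ w).hasFDerivAt.mul hst).fderiv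
      rw [hm e, hm e']
      simp only [Function.comp_apply, add_apply, smul_apply, smul_eq_mul]
      ring
    · have h0 : ∀ w, x ∉ tsupport (fun y => φ y * fderiv ℝ ρ y w) := fun w h => hxφ (hsub' w h)
      have h1 : ∀ w, x ∉ tsupport (fun y => (φ y * fderiv ℝ ρ y w) * stepDown (k * ρ y)) :=
        fun w h => h0 w (tsupport_mul_subset_left h)
      simp only [fderiv_eq_zero_of_notMem_tsupport (h0 _),
        fderiv_eq_zero_of_notMem_tsupport (h1 _)]
      simp
  have hDi : IntegrableOn D Ω μ := (hint e' e).sub (hint e e')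
  have hcomb : ∀ k : ℕ, ∫ x in Ω, stepDown (k * ρ x) * D x ∂μ = 0 := by
    intro k
    rw [← setIntegral_congr_fun hΩ.measurableSet (hpt k),
      integral_sub (hFi k e' e).integrableOn (hFi k e e').integrableOn, hzero, hzero, sub_zero]
  have hlim : Tendsto (fun k : ℕ => ∫ x in Ω, stepDown (k * ρ x) * D x ∂μ) atTop
      (𝓝 (∫ x in Ω, D x ∂μ)) := by
    refine tendsto_integral_of_dominated_convergence (fun x => |D x|) (fun k => ?_) hDi.abs
      (fun k => ?_) ?_
    · exact (((hFi k e' e).integrableOn.sub (hFi k e e').integrableOn).congr_fun (hpt k)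
        hΩ.measurableSet).aestronglyMeasurable
    · refine ae_of_all _ fun x => ?_
      rw [Real.norm_eq_abs, abs_mul]
      exact mul_le_of_le_one_left (abs_nonneg _) (abs_stepDown_le_one _)
    · filter_upwards [ae_restrict_mem hΩ.measurableSet] with x hx
      by_cases hxφ : x ∈ tsupport φ
      · have hneg : ρ x < 0 := (hdef x (hsub hxφ)).1 hx
        have h1 : Tendsto (fun k : ℕ => (k : ℝ) * ρ x) atTop atBot :=
          tendsto_natCast_atTop_atTop.atTop_mul_const_of_neg hneg
        refine tendsto_const_nhds.congr' ?_
        filter_upwards [h1.eventually_le_atBot (-2)] with k hk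
        rw [stepDown_eq_one hk, one_mul]
      · have h0 : ∀ w, x ∉ tsupport (fun y => φ y * fderiv ℝ ρ y w) := fun w h => hxφ (hsub' w h)
        simp only [hD, fderiv_eq_zero_of_notMem_tsupport (h0 _)]
        simp
  have h0 := tendsto_nhds_unique hlim (by simp only [hcomb]; exact tendsto_const_nhds)
  rw [hD, integral_sub (hint e' e) (hint e e')] at h0
  linarith

end Calculus

/-! ### Boundary charts as Lipschitz graphs over the tangent hyperplane. -/

section Graph

variable {E : Type*} [NormedAddCommGroup E] [InnerProductSpace ℝ E]

/-- The point with height `t` along `e` and horizontal coordinate `y`, from the origin `x₀`. -/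
def axisPoint (x₀ e : E) (t : ℝ) (y : (ℝ ∙ e)ᗮ) : E := x₀ + t • e + y

/-- The open cylinder of radius and half-height `a` around `x₀` with axis `e`. -/
def axisCylinder (x₀ e : E) (a : ℝ) : Set E :=
  {x | |inner ℝ e (x - x₀)| < a ∧ ‖(ℝ ∙ e)ᗮ.orthogonalProjectionOnto (x - x₀)‖ < a}

theorem inner_axisPoint_sub {x₀ e : E} (he : ‖e‖ = 1) (t : ℝ) (y : (ℝ ∙ e)ᗮ) :
    inner ℝ e (axisPoint x₀ e t y - x₀) = t := by
  have h1 : inner ℝ e (y : E) = 0 := Submodule.mem_orthogonal_singleton_iff_inner_right.1 y.2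
  have h2 : axisPoint x₀ e t y - x₀ = t • e + y := by simp only [axisPoint]; abel
  rw [h2, inner_add_right, inner_smul_right, h1, real_inner_self_eq_norm_sq, he]
  simp

theorem orthogonalProjectionOnto_axisPoint_sub (x₀ e : E) (t : ℝ) (y : (ℝ ∙ e)ᗮ) :
    (ℝ ∙ e)ᗮ.orthogonalProjectionOnto (axisPoint x₀ e t y - x₀) = y := by
  have h2 : axisPoint x₀ e t y - x₀ = t • e + y := by simp only [axisPoint]; abel
  rw [h2, map_add, map_smul]
  have h3 : (ℝ ∙ e)ᗮ.orthogonalProjectionOnto e = 0 :=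
    Submodule.orthogonalProjectionOnto_apply_of_mem_orthogonal
      (Submodule.le_orthogonal_orthogonal _ (Submodule.mem_span_singleton_self e))
  rw [h3]
  simp

theorem axisPoint_coord {x₀ e : E} (he : ‖e‖ = 1) (x : E) :
    axisPoint x₀ e (inner ℝ e (x - x₀)) ((ℝ ∙ e)ᗮ.orthogonalProjectionOnto (x - x₀)) = x := by
  have h := Submodule.starProjection_add_starProjection_orthogonal (K := ℝ ∙ e) (x - x₀)
  rw [Submodule.starProjection_unit_singleton ℝ he] at h
  rw [axisPoint, add_assoc]
  erw [h]
  abel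

theorem axisPoint_mem_axisCylinder {x₀ e : E} (he : ‖e‖ = 1) {a t : ℝ} {y : (ℝ ∙ e)ᗮ} :
    axisPoint x₀ e t y ∈ axisCylinder x₀ e a ↔ |t| < a ∧ ‖y‖ < a := by
  rw [axisCylinder, Set.mem_ofPred_eq, inner_axisPoint_sub he,
    orthogonalProjectionOnto_axisPoint_sub]

theorem axisPoint_sub_axisPoint (x₀ e : E) (t t' : ℝ) (y y' : (ℝ ∙ e)ᗮ) :
    axisPoint x₀ e t y - axisPoint x₀ e t' y' = (t - t') • e + ((y - y' : (ℝ ∙ e)ᗮ) : E) := by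
  simp only [axisPoint, Submodule.coe_sub, sub_smul]
  abel

theorem norm_axisPoint_sub_le {x₀ e : E} (he : ‖e‖ = 1) (t t' : ℝ) (y y' : (ℝ ∙ e)ᗮ) :
    ‖axisPoint x₀ e t y - axisPoint x₀ e t' y'‖ ≤ |t - t'| + ‖y - y'‖ := by
  rw [axisPoint_sub_axisPoint]
  refine (norm_add_le _ _).trans ?_
  rw [norm_smul, he, mul_one, Real.norm_eq_abs]
  rfl

theorem isOpen_axisCylinder (x₀ e : E) (a : ℝ) : IsOpen (axisCylinder x₀ e a) := by
  have h1 : Continuous fun x => |inner ℝ e (x - x₀)| := by fun_prop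
  have h2 : Continuous fun x => ‖(ℝ ∙ e)ᗮ.orthogonalProjectionOnto (x - x₀)‖ := by fun_prop
  exact (isOpen_lt h1 continuous_const).inter (isOpen_lt h2 continuous_const)

theorem axisCylinder_subset_ball {x₀ e : E} (he : ‖e‖ = 1) {a : ℝ} :
    axisCylinder x₀ e a ⊆ Metric.ball x₀ (2 * a) := by
  intro x hx
  have h0 : axisPoint x₀ e 0 0 = x₀ := by simp [axisPoint]
  have h := norm_axisPoint_sub_le (x₀ := x₀) he (inner ℝ e (x - x₀)) 0
    ((ℝ ∙ e)ᗮ.orthogonalProjectionOnto (x - x₀)) 0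
  rw [h0, axisPoint_coord he, sub_zero, sub_zero] at h
  rw [mem_ball_iff_norm]
  linarith [hx.1, hx.2]

@[fun_prop]
theorem continuous_axisPoint (x₀ e : E) :
    Continuous fun p : ℝ × (ℝ ∙ e)ᗮ => axisPoint x₀ e p.1 p.2 := by
  unfold axisPoint
  fun_prop

/-- The homeomorphism `ℝ × e^⊥ ≃ E` given by `axisPoint`. -/
noncomputable def axisHomeomorph (x₀ : E) {e : E} (he : ‖e‖ = 1) : ℝ × (ℝ ∙ e)ᗮ ≃ₜ E where
  toFun p := axisPoint x₀ e p.1 p.2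
  invFun x := (inner ℝ e (x - x₀), (ℝ ∙ e)ᗮ.orthogonalProjectionOnto (x - x₀))
  left_inv p := by simp [inner_axisPoint_sub he, orthogonalProjectionOnto_axisPoint_sub]
  right_inv x := axisPoint_coord he x
  continuous_toFun := by fun_prop
  continuous_invFun := by fun_prop

theorem measurePreserving_axisPoint [FiniteDimensional ℝ E] [MeasurableSpace E] [BorelSpace E]
    (x₀ : E) {e : E} (he : ‖e‖ = 1) :
    MeasurePreserving (fun p : ℝ × (ℝ ∙ e)ᗮ => axisPoint x₀ e p.1 p.2) volume volume := by
  have h1 : MeasurePreserving (Prod.map (LinearIsometryEquiv.toSpanUnitSingleton e he)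
      (id : (ℝ ∙ e)ᗮ → (ℝ ∙ e)ᗮ)) (volume : Measure (ℝ × (ℝ ∙ e)ᗮ)) volume :=
    (LinearIsometryEquiv.measurePreserving _).prod (MeasurePreserving.id _)
  have h2 := (WithLp.volume_preserving_toLp (ℝ ∙ e) (ℝ ∙ e)ᗮ).comp h1
  have h3 := ((ℝ ∙ e).orthogonalDecomposition.symm.measurePreserving).comp h2
  have h4 := (measurePreserving_add_left (volume : Measure E) x₀).comp h3
  convert! h4 using 1
  ext p
  simp [axisPoint, add_assoc]

/-- Inside the cylinder of axis `e` around `x₀`, the set `Ω` is the region below the graph of the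
`ε`-Lipschitz function `g`. -/
structure IsGraphChart (Ω : Set E) (x₀ e : E) (ε a : ℝ) (g : (ℝ ∙ e)ᗮ → ℝ) : Prop where
  norm_eq : ‖e‖ = 1
  nonneg : 0 ≤ ε
  pos : 0 < a
  abs_lt : ∀ y, ‖y‖ < a → |g y| < a
  mem_iff : ∀ y t, ‖y‖ < a → |t| < a → (axisPoint x₀ e t y ∈ Ω ↔ t < g y)
  mem_frontier_iff : ∀ y t, ‖y‖ < a → |t| < a → (axisPoint x₀ e t y ∈ frontier Ω ↔ t = g y)
  lipschitz : ∀ y y', ‖y‖ < a → ‖y'‖ < a → |g y - g y'| ≤ ε * ‖y - y'‖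

theorem eq_zero_of_mem_frontier_of_defining {X : Type*} [TopologicalSpace X] {Ω U : Set X}
    {ρ : X → ℝ} (hΩ : IsOpen Ω) (hU : IsOpen U) (hρ : ContinuousOn ρ U)
    (hdef : ∀ x ∈ U, x ∈ Ω ↔ ρ x < 0) {x : X} (hx : x ∈ U) (hxf : x ∈ frontier Ω) : ρ x = 0 := by
  rw [hΩ.frontier_eq] at hxf
  refine le_antisymm ?_ (not_lt.1 fun h => hxf.2 ((hdef x hx).2 h))
  by_contra! hpos
  have h1 : ∀ᶠ y in 𝓝 x, y ∈ U ∧ 0 < ρ y :=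
    (hU.eventually_mem hx).and
      ((hρ.continuousAt (hU.mem_nhds hx)).eventually_const_lt hpos)
  obtain ⟨y, hy, hyΩ⟩ := mem_closure_iff_nhds.1 hxf.1 _ h1
  exact absurd ((hdef y hy.1).1 hyΩ) (not_lt.2 hy.2.le)

/-- Strict differentiability makes `ρ` differ from `c` times the height by a function of Lipschitz
constant `κc` near `x₀`. So `ρ` increases along the axis, the intermediate value theorem yields its
zero `g y`, and comparing two zeros bounds the slope of `g` by `κ/(1 - κ) ≤ 2κ = ε`. The slope can
be made arbitrarily small because the axis is parallel to the gradient. -/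
theorem exists_isGraphChart [CompleteSpace E] {Ω U N : Set E} {x₀ : E} {ρ : E → ℝ} (hΩ : IsOpen Ω)
    (hU : IsOpen U) (hxU : x₀ ∈ U) (hx₀ : x₀ ∈ frontier Ω) (hρ : ContinuousOn ρ U)
    (hdef : ∀ x ∈ U, x ∈ Ω ↔ ρ x < 0) {ρ' : E →L[ℝ] ℝ} (hstrict : HasStrictFDerivAt ρ ρ' x₀)
    {e : E} (he : ‖e‖ = 1) {c : ℝ} (hc : 0 < c) (hρ' : ∀ w, ρ' w = c * inner ℝ e w)
    (hN : N ∈ 𝓝 x₀) {ε : ℝ} (hε : 0 < ε) (hε1 : ε ≤ 1 / 2) :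
    ∃ a g, IsGraphChart Ω x₀ e ε a g ∧ axisCylinder x₀ e a ⊆ N := by
  have hnot : ∀ x ∈ U, x ∈ frontier Ω → ρ x = 0 := fun x hx hxf =>
    eq_zero_of_mem_frontier_of_defining hΩ hU hρ hdef hx hxf
  have hρ0 := hnot x₀ hxU hx₀
  set κ : ℝ := ε / 2 with hκ
  have hκ0 : 0 < κ := by positivity
  have hbound := hstrict.isLittleO.def (c := κ * c) (by positivity)
  rw [nhds_prod_eq, eventually_prod_self_iff'] at hbound
  obtain ⟨V, hV, hbound⟩ := hbound
  obtain ⟨r, hr, hball⟩ := Metric.mem_nhds_iff.1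
    (inter_mem hV (inter_mem hN (hU.mem_nhds hxU)))
  -- Points of the cylinder, caps `|t| = a` included, are within `2a < r` of `x₀`.
  set a : ℝ := r / 3 with ha
  have ha0 : 0 < a := by positivity
  -- points of the closed cylinder lie in the ball
  have hin : ∀ t (y : (ℝ ∙ e)ᗮ), |t| ≤ a → ‖y‖ < a → axisPoint x₀ e t y ∈ Metric.ball x₀ r := by
    intro t y ht hy
    have h := norm_axisPoint_sub_le (x₀ := x₀) he t 0 y 0
    have h0 : axisPoint x₀ e 0 0 = x₀ := by simp [axisPoint]
    rw [h0, sub_zero, sub_zero] at h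
    rw [mem_ball_iff_norm]
    linarith
  have hest : ∀ t (y : (ℝ ∙ e)ᗮ) t' (y' : (ℝ ∙ e)ᗮ), |t| ≤ a → ‖y‖ < a → |t'| ≤ a → ‖y'‖ < a →
      |ρ (axisPoint x₀ e t y) - ρ (axisPoint x₀ e t' y') - c * (t - t')| ≤
        κ * c * (|t - t'| + ‖y - y'‖) := by
    intro t y t' y' ht hy ht' hy'
    have h1 := hbound _ (hball (hin t y ht hy)).1 _ (hball (hin t' y' ht' hy')).1
    have h2 : ρ' (axisPoint x₀ e t y - axisPoint x₀ e t' y') = c * (t - t') := by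
      rw [hρ', ← sub_sub_sub_cancel_right _ _ x₀, inner_sub_right, inner_axisPoint_sub he,
        inner_axisPoint_sub he]
    simp only [h2, Real.norm_eq_abs] at h1
    exact h1.trans (mul_le_mul_of_nonneg_left (norm_axisPoint_sub_le he t t' y y') (by positivity))
  have hmono : ∀ (y : (ℝ ∙ e)ᗮ) t t', ‖y‖ < a → |t| ≤ a → |t'| ≤ a → t < t' →
      ρ (axisPoint x₀ e t y) < ρ (axisPoint x₀ e t' y) := by
    intro y t t' hy ht ht' htt
    have h := hest t' y t y ht' hy ht hy
    rw [sub_self, norm_zero, add_zero, abs_of_pos (sub_pos.2 htt)] at h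
    have h1 := (abs_le.1 h).1
    have h2 : κ * c * (t' - t) ≤ (1 / 4) * (c * (t' - t)) := by
      have : 0 < c * (t' - t) := mul_pos hc (sub_pos.2 htt)
      nlinarith
    have : 0 < c * (t' - t) := mul_pos hc (sub_pos.2 htt)
    linarith
  have h0 : axisPoint x₀ e 0 0 = x₀ := by simp [axisPoint]
  -- At the caps the linear part is `±ca`, whereas the error `κc(a + ‖y‖)` is at most `ca/2` since
  -- `κ ≤ 1/4`.
  have hends : ∀ y : (ℝ ∙ e)ᗮ, ‖y‖ < a →
      ρ (axisPoint x₀ e (-a) y) < 0 ∧ 0 < ρ (axisPoint x₀ e a y) := by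
    intro y hy
    have h1 := hest (-a) y 0 0 (by rw [abs_neg, abs_of_pos ha0]) hy (by simp [ha0.le]) (by simpa)
    have h2 := hest a y 0 0 (by rw [abs_of_pos ha0]) hy (by simp [ha0.le]) (by simpa)
    rw [h0, hρ0, sub_zero, sub_zero, sub_zero] at h1 h2
    rw [abs_neg] at h1
    rw [abs_of_pos ha0] at h1 h2
    have h3 : κ * c * (a + ‖y‖) ≤ (1 / 4) * c * (2 * a) := by
      have : κ * c ≤ 1 / 4 * c := by nlinarith
      exact mul_le_mul this (by linarith) (by positivity) (by positivity)
    have h4 : 0 < c * a := mul_pos hc ha0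
    constructor
    · have := (abs_le.1 h1).2; nlinarith
    · have := (abs_le.1 h2).1; nlinarith
  have hcont : ∀ y : (ℝ ∙ e)ᗮ, ‖y‖ < a →
      ContinuousOn (fun t => ρ (axisPoint x₀ e t y)) (Set.Icc (-a) a) := by
    intro y hy
    refine hρ.comp (by unfold axisPoint; fun_prop) fun t ht => ?_
    exact (hball (hin t y (abs_le.2 ht) hy)).2.2
  have hex : ∀ y : (ℝ ∙ e)ᗮ, ∃ t, ‖y‖ < a → |t| < a ∧ ρ (axisPoint x₀ e t y) = 0 := by
    intro y
    by_cases hy : ‖y‖ < a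
    · obtain ⟨t, ht, ht0⟩ := intermediate_value_Ioo (by linarith : -a ≤ a) (hcont y hy) (hends y hy)
      exact ⟨t, fun _ => ⟨abs_lt.2 ht, ht0⟩⟩
    · exact ⟨0, fun h => absurd h hy⟩
  choose g hg using hex
  have hlt : ∀ y t, ‖y‖ < a → |t| < a → (axisPoint x₀ e t y ∈ Ω ↔ t < g y) := by
    intro y t hy ht
    rw [hdef _ (hball (hin t y ht.le hy)).2.2]
    constructor
    · intro h
      by_contra! h'
      rcases h'.lt_or_eq with h' | h'
      · have := hmono y _ _ hy (hg y hy).1.le ht.le h'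
        rw [(hg y hy).2] at this
        linarith
      · rw [← h', (hg y hy).2] at h
        exact lt_irrefl _ h
    · intro h
      have := hmono y _ _ hy ht.le (hg y hy).1.le h
      rwa [(hg y hy).2] at this
  refine ⟨a, g, ⟨he, hε.le, ha0, fun y hy => (hg y hy).1, hlt, ?_, ?_⟩, ?_⟩
  · intro y t hy ht
    constructor
    · intro h
      have h1 := hnot _ (hball (hin t y ht.le hy)).2.2 h
      rcases lt_trichotomy t (g y) with h2 | h2 | h2
      · have := hmono y _ _ hy ht.le (hg y hy).1.le h2
        rw [(hg y hy).2] at this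
        linarith
      · exact h2
      · have := hmono y _ _ hy (hg y hy).1.le ht.le h2
        rw [(hg y hy).2] at this
        linarith
    · intro h
      rw [hΩ.frontier_eq]
      refine ⟨?_, fun h' => ?_⟩
      · have h1 : Tendsto (fun s => axisPoint x₀ e s y) (𝓝[<] t) (𝓝 (axisPoint x₀ e t y)) := by
          have : Continuous fun s => axisPoint x₀ e s y := by unfold axisPoint; fun_prop
          exact this.continuousAt.tendsto.mono_left nhdsWithin_le_nhds
        refine mem_closure_of_tendsto h1 ?_
        have h2 : ∀ᶠ s in 𝓝 t, |s| < a := continuous_abs.continuousAt.eventually_lt_const ht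
        filter_upwards [h2.filter_mono nhdsWithin_le_nhds, self_mem_nhdsWithin] with s hs hs'
        exact (hlt y s hy hs).2 (h ▸ hs')
      · exact absurd ((hlt y t hy ht).1 h') (by rw [h]; exact lt_irrefl _)
  · intro y y' hy hy'
    have h := hest (g y) y (g y') y' (hg y hy).1.le hy (hg y' hy').1.le hy'
    rw [(hg y hy).2, (hg y' hy').2, sub_zero, zero_sub, abs_neg, abs_mul, abs_of_pos hc] at h
    have h1 : |g y - g y'| ≤ κ * (|g y - g y'| + ‖y - y'‖) := by
      have : c * |g y - g y'| ≤ c * (κ * (|g y - g y'| + ‖y - y'‖)) := by linarith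
      exact le_of_mul_le_mul_left this hc
    have h2 : κ * |g y - g y'| ≤ (1 / 4) * |g y - g y'| :=
      mul_le_mul_of_nonneg_right (by linarith) (abs_nonneg _)
    have h3 : 0 ≤ κ * ‖y - y'‖ := by positivity
    have h4 : ε * ‖y - y'‖ = 2 * (κ * ‖y - y'‖) := by rw [hκ]; ring
    rw [h4]
    linarith
  · refine (axisCylinder_subset_ball he).trans fun x hx => ?_
    exact (hball (Metric.ball_subset_ball (by linarith) hx)).2.1

end Graph

/-! ### Integration over graph charts, and graph measure against Hausdorff measure. -/

section GraphIntegral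

variable {E : Type*} [NormedAddCommGroup E] [InnerProductSpace ℝ E]
  {Ω : Set E} {x₀ e : E} {ε a : ℝ} {g : (ℝ ∙ e)ᗮ → ℝ}

/-- The Lipschitz bound places in `Ω` a truncated open cone `C` with vertex `x₀`, opening along
`-e`. It is convex with nonempty interior and has `x₀` in its closure, which suffices for unique
differentiability. -/
theorem IsGraphChart.uniqueDiffWithinAt_closure (h : IsGraphChart Ω x₀ e ε a g)
    (hx₀ : x₀ ∈ frontier Ω) : UniqueDiffWithinAt ℝ (closure Ω) x₀ := by
  have he := h.norm_eq
  have h0 : axisPoint x₀ e 0 0 = x₀ := by simp [axisPoint]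
  have hg0 : g 0 = 0 :=
    ((h.mem_frontier_iff 0 0 (by simpa using h.pos) (by simpa using h.pos)).1 (by rwa [h0])).symm
  set p := (ℝ ∙ e)ᗮ.orthogonalProjectionOnto with hp
  set C : Set E := Metric.ball x₀ a ∩ {x | inner ℝ e (x - x₀) + ε * ‖p (x - x₀)‖ < 0} with hC
  have hCΩ : C ⊆ Ω := by
    rintro x ⟨hx, hx'⟩
    have hxa : ‖x - x₀‖ < a := mem_ball_iff_norm.1 hx
    have h1 : ‖p (x - x₀)‖ < a := (Submodule.norm_orthogonalProjectionOnto_apply_le _ _).trans_lt hxa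
    have h2 : |inner ℝ e (x - x₀)| < a := by
      have := abs_real_inner_le_norm e (x - x₀)
      rw [he, one_mul] at this
      exact this.trans_lt hxa
    rw [← axisPoint_coord (x₀ := x₀) he x, h.mem_iff _ _ h1 h2]
    have h3 := (abs_le.1 (h.lipschitz _ 0 h1 (by simpa using h.pos))).1
    rw [hg0, sub_zero, sub_zero] at h3
    have h4 : inner ℝ e (x - x₀) + ε * ‖p (x - x₀)‖ < 0 := hx'
    linarith
  have hopen : IsOpen C := by
    have h1 : Continuous fun x => inner ℝ e (x - x₀) + ε * ‖p (x - x₀)‖ := by fun_prop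
    exact Metric.isOpen_ball.inter (isOpen_lt h1 continuous_const)
  have hconv : Convex ℝ C := by
    refine (convex_ball _ _).inter ?_
    intro x hx y hy s t hs ht hst
    simp only [Set.mem_ofPred_eq] at hx hy ⊢
    have h1 : s • x + t • y - x₀ = s • (x - x₀) + t • (y - x₀) := by
      have : x₀ = (s + t) • x₀ := by rw [hst, one_smul]
      conv_lhs => rw [this]
      module
    rw [h1, inner_add_right, inner_smul_right, inner_smul_right, map_add, map_smul, map_smul]
    have h2 := norm_add_le (s • p (x - x₀)) (t • p (y - x₀))
    rw [norm_smul, norm_smul, Real.norm_of_nonneg hs, Real.norm_of_nonneg ht] at h2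
    have h3 := mul_le_mul_of_nonneg_left h2 h.nonneg
    -- The strict inequality must come from a point with positive weight: `y` when `s = 0`,
    -- otherwise `x`.
    rcases hs.eq_or_lt with rfl | hs'
    · have : t = 1 := by linarith
      subst this
      simp only [zero_smul, zero_add, one_smul] at *
      linarith
    · have h4 := mul_neg_of_pos_of_neg hs' hx
      have h5 := mul_nonpos_of_nonneg_of_nonpos ht hy.le
      linarith
  have hlim : Tendsto (fun s : ℝ => x₀ - s • e) (𝓝[>] 0) (𝓝 x₀) := by
    have h1 : Continuous fun s : ℝ => x₀ - s • e := by fun_prop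
    have h2 := h1.tendsto 0
    simp only [zero_smul, sub_zero] at h2
    exact h2.mono_left nhdsWithin_le_nhds
  have hev : ∀ᶠ s in 𝓝[>] (0 : ℝ), x₀ - s • e ∈ C := by
    have h1 := hlim.eventually (Metric.ball_mem_nhds x₀ h.pos)
    filter_upwards [h1, self_mem_nhdsWithin] with s hs hs'
    refine ⟨hs, ?_⟩
    have h3 : p e = 0 := Submodule.orthogonalProjectionOnto_apply_of_mem_orthogonal
      (Submodule.le_orthogonal_orthogonal _ (Submodule.mem_span_singleton_self e))
    have h4 : x₀ - s • e - x₀ = -(s • e) := by abel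
    simp only [Set.mem_ofPred_eq]
    rw [h4, map_neg, map_smul, h3, inner_neg_right, inner_smul_right, real_inner_self_eq_norm_sq,
      he]
    simpa using hs'
  have hcl : x₀ ∈ closure C := mem_closure_of_tendsto hlim hev
  have hne : (interior C).Nonempty := by
    rw [hopen.interior_eq]
    obtain ⟨s, hs⟩ := hev.exists
    exact ⟨_, hs⟩
  exact (uniqueDiffWithinAt_convex hconv hne hcl).mono (hCΩ.trans subset_closure)

variable [FiniteDimensional ℝ E] [MeasurableSpace E] [BorelSpace E]

/-- The divergence theorem in the direction of the axis of a graph chart. -/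
theorem IsGraphChart.setIntegral_fderiv (h : IsGraphChart Ω x₀ e ε a g) (hΩ : IsOpen Ω)
    (hd : UniqueDiffOn ℝ (closure Ω)) {φ : E → ℝ} (hφ : ContDiffOn ℝ 1 φ (closure Ω))
    (hc : HasCompactSupport φ) (hsub : tsupport φ ⊆ axisCylinder x₀ e a) :
    ∫ x in Ω, fderiv ℝ φ x e = ∫ y in Metric.ball 0 a, φ (axisPoint x₀ e (g y) y) := by
  have he := h.norm_eq
  set F : E → ℝ := Ω.indicator fun x => fderiv ℝ φ x e with hF
  have hFi : Integrable F := (integrableOn_fderiv_of_contDiffOn_closure hΩ hd hφ hc e).integrable_indicator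
    hΩ.measurableSet
  have hmp := measurePreserving_axisPoint x₀ he
  have hemb : MeasurableEmbedding (fun p : ℝ × (ℝ ∙ e)ᗮ => axisPoint x₀ e p.1 p.2) :=
    (axisHomeomorph x₀ he).measurableEmbedding
  have hFi' : Integrable (fun p : ℝ × (ℝ ∙ e)ᗮ => F (axisPoint x₀ e p.1 p.2)) :=
    (hmp.integrable_comp_emb hemb).2 hFi
  rw [← integral_indicator hΩ.measurableSet, ← hmp.integral_comp hemb, Measure.volume_eq_prod,
    integral_prod_symm _ (by rwa [← Measure.volume_eq_prod]),
    ← integral_indicator Metric.isOpen_ball.measurableSet]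
  have hFi2 : ∀ᵐ y : (ℝ ∙ e)ᗮ, Integrable (fun t : ℝ => F (axisPoint x₀ e t y)) := by
    rw [Measure.volume_eq_prod] at hFi'
    exact hFi'.prod_left_ae
  refine integral_congr_ae ?_
  filter_upwards [hFi2] with y hy
  have hout : ∀ t : ℝ, ¬(|t| < a ∧ ‖y‖ < a) → axisPoint x₀ e t y ∉ tsupport φ := fun t ht h' =>
    ht ((axisPoint_mem_axisCylinder he).1 (hsub h'))
  by_cases hya : ‖y‖ < a
  swap
  · rw [Set.indicator_of_notMem (by simpa using hya)]
    refine integral_eq_zero_of_ae (ae_of_all _ fun t => ?_)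
    refine Set.indicator_apply_eq_zero.2 fun _ => ?_
    rw [fderiv_eq_zero_of_notMem_tsupport (hout t fun h => hya h.2)]
    rfl
  rw [Set.indicator_of_mem (by simpa using hya)]
  have hga := _root_.abs_lt.1 (h.abs_lt y hya)
  -- Heights with `|t| ≥ a` contribute nothing, as they lie off the support; the endpoint `t = g y`
  -- is not in `Ω` but is a null set.
  have hind : (fun t : ℝ => F (axisPoint x₀ e t y)) =ᵐ[volume]
      (Set.Ioc (-a) (g y)).indicator fun t => fderiv ℝ φ (axisPoint x₀ e t y) e := by
    have hne : ∀ᵐ t : ℝ, t ≠ g y := by simp [ae_iff]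
    filter_upwards [hne] with t ht
    by_cases hta : |t| < a
    · have h1 := _root_.abs_lt.1 hta
      by_cases htg : t < g y
      · rw [hF, Set.indicator_of_mem ((h.mem_iff y t hya hta).2 htg),
          Set.indicator_of_mem (s := Set.Ioc (-a) (g y)) ⟨h1.1, htg.le⟩]
      · rw [hF, Set.indicator_of_notMem fun h' => htg ((h.mem_iff y t hya hta).1 h'),
          Set.indicator_of_notMem (s := Set.Ioc (-a) (g y)) fun h' => htg (lt_of_le_of_ne h'.2 ht)]
    · have h1 : fderiv ℝ φ (axisPoint x₀ e t y) e = 0 := by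
        rw [fderiv_eq_zero_of_notMem_tsupport (hout t fun h => hta h.1)]
        rfl
      have h2 : F (axisPoint x₀ e t y) = 0 :=
        (Set.indicator_apply_eq_zero (f := fun x => fderiv ℝ φ x e)).2 fun _ => h1
      rw [h2]
      exact ((Set.indicator_apply_eq_zero
        (f := fun t => fderiv ℝ φ (axisPoint x₀ e t y) e)).2 fun _ => h1).symm
  have hint : IntervalIntegrable (fun t => fderiv ℝ φ (axisPoint x₀ e t y) e) volume (-a) (g y) := by
    rw [intervalIntegrable_iff_integrableOn_Ioc_of_le hga.1.le,
      ← integrable_indicator_iff measurableSet_Ioc]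
    exact hy.congr hind
  have hline : ∀ t, HasDerivAt (fun t => axisPoint x₀ e t y) e t := by
    intro t
    have := (((hasDerivAt_id t).smul_const e).const_add x₀).add_const (y : E)
    simpa [axisPoint] using this
  rw [integral_congr_ae hind, integral_indicator measurableSet_Ioc,
    ← intervalIntegral.integral_of_le hga.1.le,
    intervalIntegral.integral_eq_sub_of_hasDerivAt_of_le (f := fun t => φ (axisPoint x₀ e t y))
      hga.1.le ?_ ?_ hint]
  -- The bottom of the fibre is outside the open cylinder, so only the value on the graph remains.
  · rw [image_eq_zero_of_notMem_tsupport (hout (-a) fun h' => ?_), sub_zero]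
    have := h'.1
    rw [abs_neg] at this
    exact absurd this (not_lt.2 (le_abs_self a))
  · intro t ht
    by_cases hta : |t| < a
    · have hmem : axisPoint x₀ e t y ∈ closure Ω := by
        rcases ht.2.lt_or_eq with h1 | h1
        · exact subset_closure ((h.mem_iff y t hya hta).2 h1)
        · exact frontier_subset_closure ((h.mem_frontier_iff y t hya hta).2 h1)
      have hmaps : ∀ᶠ s in 𝓝[Set.Icc (-a) (g y)] t, axisPoint x₀ e s y ∈ closure Ω := by
        have h2 : ∀ᶠ s in 𝓝 t, |s| < a := continuous_abs.continuousAt.eventually_lt_const hta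
        filter_upwards [h2.filter_mono nhdsWithin_le_nhds, self_mem_nhdsWithin] with s hs hs'
        rcases hs'.2.lt_or_eq with h1 | h1
        · exact subset_closure ((h.mem_iff y s hya hs).2 h1)
        · exact frontier_subset_closure ((h.mem_frontier_iff y s hya hs).2 h1)
      exact (hφ.continuousOn _ hmem).tendsto.comp (tendsto_nhdsWithin_iff.2
        ⟨(hline t).continuousAt.tendsto.mono_left nhdsWithin_le_nhds, hmaps⟩)
    · have h0 := notMem_tsupport_iff_eventuallyEq.1 (hout t fun h => hta h.1)
      have h1 : ContinuousAt φ (axisPoint x₀ e t y) :=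
        (continuousAt_const (y := (0 : ℝ))).congr h0.symm
      exact (ContinuousAt.comp (f := fun t => axisPoint x₀ e t y) h1
        (hline t).continuousAt).continuousWithinAt
  · intro t ht
    have hta : |t| < a := _root_.abs_lt.2 ⟨ht.1, ht.2.trans hga.2⟩
    have hmem := (h.mem_iff y t hya hta).2 ht.2
    have hd1 : DifferentiableAt ℝ φ (axisPoint x₀ e t y) :=
      ((hφ _ (subset_closure hmem)).contDiffAt
        (mem_of_superset (hΩ.mem_nhds hmem) subset_closure)).differentiableAt one_ne_zero
    exact hd1.hasFDerivAt.comp_hasDerivAt t (hline t)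

omit [InnerProductSpace ℝ E] [FiniteDimensional ℝ E] in
theorem LipschitzOnWith.euclideanHausdorffMeasure_image_le {X : Type*} [EMetricSpace X]
    [MeasurableSpace X] [BorelSpace X] {K : NNReal} {f : X → E} {s : Set X}
    (h : LipschitzOnWith K f s) (d : ℕ) :
    Measure.euclideanHausdorffMeasure d (f '' s) ≤
      (K : ENNReal) ^ d * Measure.euclideanHausdorffMeasure d s := by
  have h1 := h.hausdorffMeasure_image_le (d := d) d.cast_nonneg
  rw [ENNReal.rpow_natCast] at h1
  simp only [Measure.euclideanHausdorffMeasure_def, Measure.smul_apply, ENNReal.smul_def,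
    smul_eq_mul]
  rw [mul_left_comm]
  gcongr

/-- The measure carried by the graph: the push-forward of Lebesgue measure on the base. -/
noncomputable def graphMeasure (x₀ e : E) (a : ℝ) (g : (ℝ ∙ e)ᗮ → ℝ) : Measure E :=
  (volume.restrict (Metric.ball 0 a)).map fun y => axisPoint x₀ e (g y) y

omit [FiniteDimensional ℝ E] [MeasurableSpace E] [BorelSpace E] in
theorem IsGraphChart.lipschitzOnWith (h : IsGraphChart Ω x₀ e ε a g) :
    LipschitzOnWith (1 + ε).toNNReal (fun y => axisPoint x₀ e (g y) y) (Metric.ball 0 a) := by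
  refine LipschitzOnWith.of_dist_le_mul fun y hy y' hy' => ?_
  rw [dist_eq_norm, dist_eq_norm, Real.coe_toNNReal _ (by linarith [h.nonneg])]
  have h1 := norm_axisPoint_sub_le (x₀ := x₀) h.norm_eq (g y) (g y') y y'
  have h2 := h.lipschitz y y' (by simpa using hy) (by simpa using hy')
  linarith

theorem IsGraphChart.aemeasurable (h : IsGraphChart Ω x₀ e ε a g) :
    AEMeasurable (fun y => axisPoint x₀ e (g y) y) (volume.restrict (Metric.ball 0 a)) :=
  h.lipschitzOnWith.continuousOn.aemeasurable Metric.isOpen_ball.measurableSet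

omit [FiniteDimensional ℝ E] [MeasurableSpace E] [BorelSpace E] in
theorem IsGraphChart.axisPoint_mem (h : IsGraphChart Ω x₀ e ε a g) {y : (ℝ ∙ e)ᗮ}
    (hy : y ∈ Metric.ball 0 a) :
    axisPoint x₀ e (g y) y ∈ frontier Ω ∩ axisCylinder x₀ e a := by
  have hy' : ‖y‖ < a := by simpa using hy
  have hg := h.abs_lt y hy'
  exact ⟨(h.mem_frontier_iff y _ hy' hg).2 rfl, (axisPoint_mem_axisCylinder h.norm_eq).2 ⟨hg, hy'⟩⟩

/-- Orthogonal projection onto the base is `1`-Lipschitz and undoes the graph map, and on the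
`d`-dimensional base the normalized Hausdorff measure is Lebesgue measure. -/
theorem IsGraphChart.graphMeasure_le (h : IsGraphChart Ω x₀ e ε a g) {d : ℕ}
    (hd : Module.finrank ℝ (ℝ ∙ e)ᗮ = d) :
    graphMeasure x₀ e a g ≤
      (Measure.euclideanHausdorffMeasure d).restrict (frontier Ω ∩ axisCylinder x₀ e a) := by
  rw [Measure.le_iff]
  intro s hs
  rw [graphMeasure, Measure.map_apply_of_aemeasurable h.aemeasurable hs,
    Measure.restrict_apply' Metric.isOpen_ball.measurableSet, Measure.restrict_apply hs,
    ← InnerProductSpace.euclideanHausdorffMeasure_eq_volume, hd]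
  set S := (fun y => axisPoint x₀ e (g y) y) ⁻¹' s ∩ Metric.ball 0 a with hS
  set p : E → (ℝ ∙ e)ᗮ := fun x => (ℝ ∙ e)ᗮ.orthogonalProjectionOnto (x - x₀) with hp
  have hp1 : LipschitzOnWith 1 p (s ∩ (frontier Ω ∩ axisCylinder x₀ e a)) := by
    refine LipschitzOnWith.of_dist_le_mul fun x _ x' _ => ?_
    rw [dist_eq_norm, dist_eq_norm, hp, ← map_sub, sub_sub_sub_cancel_right, NNReal.coe_one,
      one_mul]
    exact Submodule.norm_orthogonalProjectionOnto_apply_le _ _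
  have hsub : S ⊆ p '' (s ∩ (frontier Ω ∩ axisCylinder x₀ e a)) := fun y hy =>
    ⟨axisPoint x₀ e (g y) y, ⟨hy.1, h.axisPoint_mem hy.2⟩,
      orthogonalProjectionOnto_axisPoint_sub _ _ _ _⟩
  have := hp1.euclideanHausdorffMeasure_image_le d
  rw [ENNReal.coe_one, one_pow, one_mul] at this
  exact (measure_mono hsub).trans this

/-- The graph map is `(1 + ε)`-Lipschitz. With the reverse bound, this pins surface measure to base
measure up to a factor tending to `1` with `ε`, so no area formula is needed. -/
theorem IsGraphChart.le_graphMeasure (h : IsGraphChart Ω x₀ e ε a g) {d : ℕ}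
    (hd : Module.finrank ℝ (ℝ ∙ e)ᗮ = d) :
    (Measure.euclideanHausdorffMeasure d).restrict (frontier Ω ∩ axisCylinder x₀ e a) ≤
      ENNReal.ofReal ((1 + ε) ^ d) • graphMeasure x₀ e a g := by
  rw [Measure.le_iff]
  intro s hs
  rw [Measure.smul_apply, graphMeasure, Measure.map_apply_of_aemeasurable h.aemeasurable hs,
    Measure.restrict_apply' Metric.isOpen_ball.measurableSet, Measure.restrict_apply hs,
    ← InnerProductSpace.euclideanHausdorffMeasure_eq_volume, hd]
  set S := (fun y => axisPoint x₀ e (g y) y) ⁻¹' s ∩ Metric.ball 0 a with hS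
  have hsub : s ∩ (frontier Ω ∩ axisCylinder x₀ e a) ⊆ (fun y => axisPoint x₀ e (g y) y) '' S := by
    rintro x ⟨hxs, hxf, hxc⟩
    have hx := axisPoint_coord (x₀ := x₀) h.norm_eq x
    have hg := (h.mem_frontier_iff _ _ hxc.2 hxc.1).1 (by rwa [hx])
    rw [hg] at hx
    exact ⟨_, ⟨by simpa only [Set.mem_preimage, hx] using hxs, by simpa using hxc.2⟩, hx⟩
  have := (h.lipschitzOnWith.mono (Set.inter_subset_right : S ⊆ _)).euclideanHausdorffMeasure_image_le d
  refine (measure_mono hsub).trans (this.trans (le_of_eq ?_))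
  rw [smul_eq_mul, ENNReal.ofReal_pow (by linarith [h.nonneg])]
  rfl

theorem IsGraphChart.euclideanHausdorffMeasure_lt_top (h : IsGraphChart Ω x₀ e ε a g) {d : ℕ}
    (hd : Module.finrank ℝ (ℝ ∙ e)ᗮ = d) :
    Measure.euclideanHausdorffMeasure d (frontier Ω ∩ axisCylinder x₀ e a) < ⊤ := by
  rw [← Measure.restrict_apply_univ]
  refine (h.le_graphMeasure hd Set.univ).trans_lt ?_
  rw [Measure.smul_apply, graphMeasure, Measure.map_apply_of_aemeasurable h.aemeasurable .univ,
    Set.preimage_univ, Measure.restrict_apply_univ]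
  exact ENNReal.mul_lt_top ENNReal.ofReal_lt_top measure_ball_lt_top

end GraphIntegral

/-- Both `|f| - f` and `|f| + f` are nonnegative, so their integrals are monotone in the measure.
This bounds the gap for `±f` by the gap for `|f|`, which the domination `ν ≤ c μ` controls. -/
theorem MeasureTheory.abs_integral_sub_integral_le_of_le_of_le_smul {α : Type*} [MeasurableSpace α]
    {μ ν : Measure α} {c : ℝ} (hc : 1 ≤ c) (h1 : μ ≤ ν) (h2 : ν ≤ ENNReal.ofReal c • μ)
    {f : α → ℝ} (hf : Integrable f ν) :
    |∫ x, f x ∂ν - ∫ x, f x ∂μ| ≤ (c - 1) * ∫ x, |f x| ∂ν := by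
  have hfμ : Integrable f μ := hf.mono_measure h1
  have hmono : ∀ g : α → ℝ, Integrable g ν → (∀ x, 0 ≤ g x) → ∫ x, g x ∂μ ≤ ∫ x, g x ∂ν :=
    fun g hg h0 => integral_mono_measure h1 (ae_of_all _ h0) hg
  have habs : ∫ x, |f x| ∂ν ≤ c * ∫ x, |f x| ∂μ := by
    have := integral_mono_measure h2 (ae_of_all _ fun x => abs_nonneg (f x))
      (hfμ.abs.smul_measure ENNReal.ofReal_ne_top)
    rwa [integral_smul_measure, ENNReal.toReal_ofReal (by linarith), smul_eq_mul] at this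
  have hle := hmono (fun x => |f x|) hf.abs fun x => abs_nonneg _
  have key : ∀ g : α → ℝ, Integrable g ν → (∀ x, |g x| = |f x|) →
      ∫ x, g x ∂ν - ∫ x, g x ∂μ ≤ (c - 1) * ∫ x, |f x| ∂ν := by
    intro g hg hgf
    have hgμ := hg.mono_measure h1
    have h3 := hmono (fun x => |g x| - g x) (hg.abs.sub hg) fun x => sub_nonneg.2 (le_abs_self _)
    rw [integral_sub hgμ.abs hgμ, integral_sub hg.abs hg] at h3
    simp only [hgf] at h3
    nlinarith
  rw [abs_le]
  constructor
  · have := key (fun x => -f x) hf.neg fun x => abs_neg _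
    rw [integral_neg, integral_neg] at this
    linarith
  · exact key f hf fun x => rfl

/-! ### The outward normal, and regularity of the boundary. -/

section LocalDefiningFunction

variable {n : ℕ} {Ω U : Set (EuclideanSpace ℝ (Fin n))} {x : EuclideanSpace ℝ (Fin n)}
  {ρ : EuclideanSpace ℝ (Fin n) → ℝ}

theorem IsLocalDefiningFunction.mem_iff (h : IsLocalDefiningFunction Ω x U ρ) :
    ∀ y ∈ U, y ∈ Ω ↔ ρ y < 0 := fun y hy => by
  have := Set.ext_iff.1 h.inter_eq y
  simpa [hy] using this

theorem IsLocalDefiningFunction.of_mem (h : IsLocalDefiningFunction Ω x U ρ)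
    {y : EuclideanSpace ℝ (Fin n)} (hy : y ∈ U) : IsLocalDefiningFunction Ω y U ρ :=
  ⟨h.isOpen, hy, h.contDiffOn, h.gradient_ne_zero, h.inter_eq⟩

theorem IsLocalDefiningFunction.contDiffAt (h : IsLocalDefiningFunction Ω x U ρ) :
    ContDiffAt ℝ 2 ρ x := (h.contDiffOn x h.mem).contDiffAt (h.isOpen.mem_nhds h.mem)

/-- If `d` points strictly inwards for one defining function, it does not point strictly outwards
for another one. -/
theorem IsLocalDefiningFunction.inner_nonpos {U' : Set (EuclideanSpace ℝ (Fin n))}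
    {ρ' : EuclideanSpace ℝ (Fin n) → ℝ} (hΩ : IsOpen Ω) (hx : x ∈ frontier Ω)
    (h : IsLocalDefiningFunction Ω x U ρ) (h' : IsLocalDefiningFunction Ω x U' ρ')
    {d : EuclideanSpace ℝ (Fin n)} (hd : inner ℝ (gradient ρ x) d < 0) :
    inner ℝ (gradient ρ' x) d ≤ 0 := by
  have hline : HasDerivAt (fun t : ℝ => x + t • d) d 0 := by
    simpa using ((hasDerivAt_id (0 : ℝ)).smul_const d).const_add x
  have hcont : ∀ V : Set (EuclideanSpace ℝ (Fin n)), IsOpen V → x ∈ V →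
      ∀ᶠ t in 𝓝[>] (0 : ℝ), x + t • d ∈ V := by
    intro V hV hxV
    have := hline.continuousAt.eventually_mem (s := V) (by simpa using hV.mem_nhds hxV)
    exact this.filter_mono nhdsWithin_le_nhds
  have hslope : ∀ (V : Set (EuclideanSpace ℝ (Fin n))) (r : EuclideanSpace ℝ (Fin n) → ℝ),
      IsLocalDefiningFunction Ω x V r →
      Tendsto (fun t : ℝ => t⁻¹ * r (x + t • d)) (𝓝[>] 0) (𝓝 (inner ℝ (gradient r x) d)) := by
    intro V r hr
    have h0 : r x = 0 := eq_zero_of_mem_frontier_of_defining hΩ hr.isOpen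
      hr.contDiffOn.continuousOn hr.mem_iff hr.mem hx
    have h1 : HasFDerivAt r (fderiv ℝ r x) (x + (0 : ℝ) • d) := by
      simpa using (hr.contDiffAt.differentiableAt two_ne_zero).hasFDerivAt
    have h2 := (h1.comp_hasDerivAt (0 : ℝ) hline).tendsto_slope_zero_right
    simpa [h0, inner_gradient_left] using h2
  refine le_of_tendsto (hslope U' ρ' h') ?_
  -- For small `t > 0` the point `x + t d` has `ρ < 0`, hence lies in `Ω`, hence has `ρ' < 0`; the
  -- sign passes to the limiting slope.
  filter_upwards [(hslope U ρ h).eventually_lt_const hd, hcont U h.isOpen h.mem,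
    hcont U' h'.isOpen h'.mem, self_mem_nhdsWithin] with t h1 h2 h3 ht
  have ht' : 0 < t⁻¹ := inv_pos.2 ht
  have h4 : ρ (x + t • d) < 0 := by
    by_contra! h5
    exact absurd h1 (not_lt.2 (mul_nonneg ht'.le h5))
  exact mul_nonpos_of_nonneg_of_nonpos ht'.le
    ((h'.mem_iff _ h3).1 ((h.mem_iff _ h2).2 h4)).le

/-- If the unit normals `a`, `b` differed, the direction `b - a` would point strictly inwards for
the first (`⟨a, b⟩ - 1 < 0`) and strictly outwards for the second (`1 - ⟨a, b⟩ > 0`). -/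
theorem IsLocalDefiningFunction.normalize_gradient_eq {U' : Set (EuclideanSpace ℝ (Fin n))}
    {ρ' : EuclideanSpace ℝ (Fin n) → ℝ} (hΩ : IsOpen Ω) (hx : x ∈ frontier Ω)
    (h : IsLocalDefiningFunction Ω x U ρ) (h' : IsLocalDefiningFunction Ω x U' ρ') :
    ‖gradient ρ x‖⁻¹ • gradient ρ x = ‖gradient ρ' x‖⁻¹ • gradient ρ' x := by
  have hn := norm_pos_iff.2 (h.gradient_ne_zero x h.mem)
  have hn' := norm_pos_iff.2 (h'.gradient_ne_zero x h'.mem)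
  set a := ‖gradient ρ x‖⁻¹ • gradient ρ x with ha
  set b := ‖gradient ρ' x‖⁻¹ • gradient ρ' x with hb
  have ha1 : ‖a‖ = 1 := by rw [ha, norm_smul, norm_inv, norm_norm, inv_mul_cancel₀ hn.ne']
  have hb1 : ‖b‖ = 1 := by rw [hb, norm_smul, norm_inv, norm_norm, inv_mul_cancel₀ hn'.ne']
  by_contra hab
  have h1 : inner ℝ a b < 1 := inner_lt_one_iff_real_of_norm_eq_one ha1 hb1 |>.2 hab
  have h2 : inner ℝ (gradient ρ x) (b - a) < 0 := by
    have h3 : inner ℝ a (b - a) < 0 := by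
      rw [inner_sub_right, real_inner_self_eq_norm_sq, ha1]
      linarith
    rw [ha, real_inner_smul_left] at h3
    by_contra! h4
    exact absurd h3 (not_lt.2 (mul_nonneg (inv_nonneg.2 hn.le) h4))
  have h5 := h.inner_nonpos hΩ hx h' h2
  have h6 : inner ℝ b (b - a) ≤ 0 := by
    conv_lhs => rw [hb, real_inner_smul_left, ← hb]
    exact mul_nonpos_of_nonneg_of_nonpos (inv_nonneg.2 hn'.le) h5
  rw [inner_sub_right, real_inner_self_eq_norm_sq, hb1, real_inner_comm] at h6
  linarith

theorem IsLocalDefiningFunction.outwardNormal_eq (hΩ : IsRegularDomain Ω) (hx : x ∈ frontier Ω)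
    (h : IsLocalDefiningFunction Ω x U ρ) :
    outwardNormal Ω x = ‖gradient ρ x‖⁻¹ • gradient ρ x := by
  obtain ⟨U', ρ', h', heq⟩ := hΩ.isOutwardUnitNormal_outwardNormal hx
  rw [heq]
  exact h'.normalize_gradient_eq hΩ.isOpen hx h

theorem IsLocalDefiningFunction.continuousOn_gradient (h : IsLocalDefiningFunction Ω x U ρ) :
    ContinuousOn (gradient ρ) U := by
  have h1 := h.contDiffOn.continuousOn_fderiv_of_isOpen h.isOpen one_le_two
  exact (InnerProductSpace.toDual ℝ _).symm.continuous.comp_continuousOn h1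

/-- The normal is chosen point by point, but by uniqueness a single defining function computes it at
all nearby boundary points. -/
theorem IsRegularDomain.continuousOn_outwardNormal (hΩ : IsRegularDomain Ω) :
    ContinuousOn (outwardNormal Ω) (frontier Ω) := by
  intro x hx
  obtain ⟨U, ρ, h⟩ := hΩ.exists_definingFunction x hx
  have h1 : ContinuousWithinAt (fun y => ‖gradient ρ y‖⁻¹ • gradient ρ y) (frontier Ω) x := by
    have h2 := (h.continuousOn_gradient x h.mem).continuousAt (h.isOpen.mem_nhds h.mem)
    exact ((h2.norm.inv₀ (norm_ne_zero_iff.2 (h.gradient_ne_zero x h.mem))).smul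
      h2).continuousWithinAt
  refine h1.congr_of_eventuallyEq ?_ (h.outwardNormal_eq hΩ hx)
  filter_upwards [mem_nhdsWithin_of_mem_nhds (h.isOpen.mem_nhds h.mem), self_mem_nhdsWithin]
    with y hy hyf
  exact (h.of_mem hy).outwardNormal_eq hΩ hyf

theorem IsLocalDefiningFunction.exists_isGraphChart (hΩ : IsRegularDomain Ω)
    (hx : x ∈ frontier Ω) (h : IsLocalDefiningFunction Ω x U ρ)
    {N : Set (EuclideanSpace ℝ (Fin n))} (hN : N ∈ 𝓝 x) {ε : ℝ} (hε : 0 < ε) (hε1 : ε ≤ 1 / 2)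
    {e : EuclideanSpace ℝ (Fin n)} (he : e = ‖gradient ρ x‖⁻¹ • gradient ρ x) :
    ∃ a g, IsGraphChart Ω x e ε a g ∧ axisCylinder x e a ⊆ N := by
  have hn := norm_pos_iff.2 (h.gradient_ne_zero x h.mem)
  subst he
  refine _root_.exists_isGraphChart hΩ.isOpen h.isOpen h.mem hx h.contDiffOn.continuousOn h.mem_iff
    (h.contDiffAt.hasStrictFDerivAt two_ne_zero) ?_ hn (fun w => ?_) hN hε hε1
  · rw [norm_smul, norm_inv, norm_norm, inv_mul_cancel₀ hn.ne']
  · rw [real_inner_smul_left, ← mul_assoc, mul_inv_cancel₀ hn.ne', one_mul, inner_gradient_left]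

theorem IsRegularDomain.uniqueDiffOn_closure (hΩ : IsRegularDomain Ω) :
    UniqueDiffOn ℝ (closure Ω) := by
  intro x hx
  rw [closure_eq_self_union_frontier] at hx
  rcases hx with hx | hx
  · exact (hΩ.isOpen.uniqueDiffWithinAt hx).mono subset_closure
  · obtain ⟨U, ρ, h⟩ := hΩ.exists_definingFunction x hx
    obtain ⟨a, g, hg, -⟩ := h.exists_isGraphChart hΩ hx univ_mem (by norm_num) le_rfl rfl
    exact hg.uniqueDiffWithinAt_closure hx

theorem finrank_orthogonal_span_singleton_euclideanSpace (hn : 1 ≤ n)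
    {e : EuclideanSpace ℝ (Fin n)} (he : ‖e‖ = 1) : Module.finrank ℝ (ℝ ∙ e)ᗮ = n - 1 := by
  have : Fact (Module.finrank ℝ (EuclideanSpace ℝ (Fin n)) = n - 1 + 1) :=
    ⟨by rw [finrank_euclideanSpace_fin]; omega⟩
  exact Submodule.finrank_orthogonal_span_singleton (by rintro rfl; simp at he)

theorem IsRegularDomain.euclideanHausdorffMeasure_lt_top (hn : 1 ≤ n) (hΩ : IsRegularDomain Ω)
    {K : Set (EuclideanSpace ℝ (Fin n))} (hK : IsCompact K) :
    μHE[n - 1] (K ∩ frontier Ω) < ⊤ := by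
  refine (hK.inter_right isClosed_frontier).measure_lt_top_of_nhdsWithin fun x hx => ?_
  obtain ⟨U, ρ, h⟩ := hΩ.exists_definingFunction x hx.2
  obtain ⟨a, g, hg, -⟩ := h.exists_isGraphChart hΩ hx.2 univ_mem (by norm_num) le_rfl rfl
  refine ⟨_, ?_, hg.euclideanHausdorffMeasure_lt_top
    (finrank_orthogonal_span_singleton_euclideanSpace hn hg.norm_eq)⟩
  have hx0 : x ∈ axisCylinder x (‖gradient ρ x‖⁻¹ • gradient ρ x) a := by
    simp [axisCylinder, hg.pos]
  exact inter_mem (mem_of_superset self_mem_nhdsWithin Set.inter_subset_right)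
    (mem_nhdsWithin_of_mem_nhds ((isOpen_axisCylinder _ _ _).mem_nhds hx0))

theorem IsRegularDomain.integrableOn_frontier (hn : 1 ≤ n) (hΩ : IsRegularDomain Ω)
    {φ : EuclideanSpace ℝ (Fin n) → ℝ} (hφ : ContinuousOn φ (frontier Ω))
    (hc : HasCompactSupport φ) : IntegrableOn φ (frontier Ω) μHE[n - 1] :=
  hφ.integrableOn_of_hasCompactSupport isClosed_frontier isClosed_frontier.measurableSet
    subset_rfl hc (hΩ.euclideanHausdorffMeasure_lt_top hn hc.isCompact).ne

theorem IsRegularDomain.integrableOn_frontier_mul_inner (hn : 1 ≤ n) (hΩ : IsRegularDomain Ω)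
    {φ : EuclideanSpace ℝ (Fin n) → ℝ} (hφ : ContinuousOn φ (closure Ω))
    (hc : HasCompactSupport φ) (w : EuclideanSpace ℝ (Fin n)) :
    IntegrableOn (fun x => φ x * inner ℝ (outwardNormal Ω x) w) (frontier Ω) μHE[n - 1] :=
  hΩ.integrableOn_frontier hn ((hφ.mono frontier_subset_closure).mul
    (hΩ.continuousOn_outwardNormal.inner continuousOn_const)) hc.mul_right

end LocalDefiningFunction

/-! ### The divergence theorem, by localization with a vanishing error. -/

section Divergence

variable {n : ℕ} {Ω : Set (EuclideanSpace ℝ (Fin n))}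

/-- The divergence theorem up to `δ` for the field `φ w`, for `φ` supported in `V`. -/
def IsAlmostDivergence (Ω : Set (EuclideanSpace ℝ (Fin n))) (w : EuclideanSpace ℝ (Fin n)) (δ : ℝ)
    (V : Set (EuclideanSpace ℝ (Fin n))) : Prop :=
  ∀ φ : EuclideanSpace ℝ (Fin n) → ℝ, ContDiffOn ℝ 1 φ (closure Ω) → HasCompactSupport φ →
    tsupport φ ⊆ V →
    |(∫ x in Ω, fderiv ℝ φ x w) - ∫ x in frontier Ω, φ x * inner ℝ (outwardNormal Ω x) w ∂μHE[n - 1]|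
      ≤ δ * ∫ x in frontier Ω, |φ x| ∂μHE[n - 1]

theorem isAlmostDivergence_of_isOpen (hΩ : IsOpen Ω) (w : EuclideanSpace ℝ (Fin n)) (δ : ℝ) :
    IsAlmostDivergence Ω w δ Ω := by
  intro φ hφ hc hsub
  have hout : ∀ x ∈ frontier Ω, φ x = 0 := fun x hx =>
    image_eq_zero_of_notMem_tsupport fun h => by
      rw [hΩ.frontier_eq] at hx
      exact hx.2 (hsub h)
  have h1 : ∫ x in frontier Ω, φ x * inner ℝ (outwardNormal Ω x) w ∂μHE[n - 1] = 0 :=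
    setIntegral_eq_zero_of_forall_eq_zero fun x hx => by rw [hout x hx, zero_mul]
  have h2 : ∫ x in frontier Ω, |φ x| ∂μHE[n - 1] = 0 :=
    setIntegral_eq_zero_of_forall_eq_zero fun x hx => by rw [hout x hx, abs_zero]
  have hφ' : ContDiff ℝ 1 φ := by
    rw [contDiff_iff_contDiffAt]
    intro x
    by_cases hx : x ∈ Ω
    · exact (hφ x (subset_closure hx)).contDiffAt
        (mem_of_superset (hΩ.mem_nhds hx) subset_closure)
    · exact contDiffAt_const.congr_of_eventuallyEq
        (notMem_tsupport_iff_eventuallyEq.1 fun h => hx (hsub h))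
  have h3 : ∫ x in Ω, fderiv ℝ φ x w = 0 := by
    rw [setIntegral_eq_integral_of_forall_compl_eq_zero]
    · exact integral_fderiv_eq_zero_of_hasCompactSupport hφ' hc w
    · intro x hx
      rw [fderiv_eq_zero_of_notMem_tsupport fun h => hx (hsub h)]
      rfl
  rw [h1, h2, h3]
  simp

theorem isAlmostDivergence_compl_closure (w : EuclideanSpace ℝ (Fin n)) (δ : ℝ) :
    IsAlmostDivergence Ω w δ (closure Ω)ᶜ := by
  intro φ hφ hc hsub
  have hout : ∀ x ∈ closure Ω, x ∉ tsupport φ := fun x hx h => hsub h hx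
  have hout' : ∀ x ∈ frontier Ω, φ x = 0 := fun x hx =>
    image_eq_zero_of_notMem_tsupport (hout x (frontier_subset_closure hx))
  have h1 : ∫ x in frontier Ω, φ x * inner ℝ (outwardNormal Ω x) w ∂μHE[n - 1] = 0 :=
    setIntegral_eq_zero_of_forall_eq_zero fun x hx => by rw [hout' x hx, zero_mul]
  have h2 : ∫ x in frontier Ω, |φ x| ∂μHE[n - 1] = 0 :=
    setIntegral_eq_zero_of_forall_eq_zero fun x hx => by rw [hout' x hx, abs_zero]
  have h3 : ∫ x in Ω, fderiv ℝ φ x w = 0 :=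
    setIntegral_eq_zero_of_forall_eq_zero fun x hx => by
      rw [fderiv_eq_zero_of_notMem_tsupport (hout x (subset_closure hx))]
      rfl
  rw [h1, h2, h3]
  simp

/-- Let `e` be the normal at `x` and `q = ∂_wρ/∂_eρ`. Writing `φ = ψ ∂_eρ`, the exchange identity
replaces `∂_w φ` by `∂_e (φ q)` under the integral, and integration along the axis gives `∫ φ q` for
the graph measure. Near `x`, `q` is close to `⟨ν, w⟩`, with equality at `x`, and the graph measure
is close to surface measure. -/
theorem IsRegularDomain.exists_isAlmostDivergence (hn : 1 ≤ n) (hΩ : IsRegularDomain Ω)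
    {x : EuclideanSpace ℝ (Fin n)} (hx : x ∈ frontier Ω) (w : EuclideanSpace ℝ (Fin n)) {δ : ℝ}
    (hδ : 0 < δ) : ∃ V, IsOpen V ∧ x ∈ V ∧ IsAlmostDivergence Ω w δ V := by
  obtain ⟨U, ρ, h⟩ := hΩ.exists_definingFunction x hx
  have hgn := norm_pos_iff.2 (h.gradient_ne_zero x h.mem)
  set e := ‖gradient ρ x‖⁻¹ • gradient ρ x with he
  have hgc := (h.continuousOn_gradient x h.mem).continuousAt (h.isOpen.mem_nhds h.mem)
  have hposx : 0 < fderiv ℝ ρ x e := by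
    rw [← inner_gradient_left, he, real_inner_smul_right, real_inner_self_eq_norm_sq]
    positivity
  have hfc : ∀ v, ContinuousAt (fun y => fderiv ℝ ρ y v) x := fun v => by
    simp only [← inner_gradient_left]
    exact hgc.inner continuousAt_const
  set q : EuclideanSpace ℝ (Fin n) → ℝ := fun y => fderiv ℝ ρ y w / fderiv ℝ ρ y e with hq
  set ν : EuclideanSpace ℝ (Fin n) → ℝ := fun y => inner ℝ (‖gradient ρ y‖⁻¹ • gradient ρ y) w
    with hν
  have hqν : q x - ν x = 0 := by
    simp only [hq, hν, ← inner_gradient_left]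
    rw [he, real_inner_smul_right, real_inner_self_eq_norm_sq, real_inner_smul_left]
    field_simp
    ring
  have hN : {y | y ∈ U ∧ 0 < fderiv ℝ ρ y e ∧ |q y - ν y| < δ / 2} ∈ 𝓝 x := by
    have h1 : ContinuousAt (fun y => |q y - ν y|) x :=
      (((hfc w).div (hfc e) hposx.ne').sub
        (((hgc.norm.inv₀ hgn.ne').smul hgc).inner continuousAt_const)).abs
    exact (h.isOpen.eventually_mem h.mem).and (((hfc e).eventually_const_lt hposx).and
      (h1.eventually_lt_const (by simp only [hqν, abs_zero]; positivity)))
  -- Half of the error budget pays for the change of measure: `(1 + ε)^(n-1) - 1` is the relative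
  -- gap and `‖w‖ + δ` bounds `|q|` on the boundary chart. The other half pays for `|q - ν| < δ/2`.
  obtain ⟨ε, hε, hε1, hεδ⟩ : ∃ ε : ℝ, 0 < ε ∧ ε ≤ 1 / 2 ∧
      ((1 + ε) ^ (n - 1) - 1) * (‖w‖ + δ) ≤ δ / 2 := by
    have h1 : Continuous fun ε : ℝ => ((1 + ε) ^ (n - 1) - 1) * (‖w‖ + δ) := by fun_prop
    have h2 : ∀ᶠ ε in 𝓝[>] (0 : ℝ), ((1 + ε) ^ (n - 1) - 1) * (‖w‖ + δ) < δ / 2 :=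
      (h1.continuousAt.eventually_lt_const (by simpa using hδ)).filter_mono nhdsWithin_le_nhds
    have h3 : ∀ᶠ ε in 𝓝[>] (0 : ℝ), ε < 1 / 2 :=
      (eventually_lt_nhds (by norm_num)).filter_mono nhdsWithin_le_nhds
    obtain ⟨ε, h4, h5, h6⟩ := (h2.and (h3.and self_mem_nhdsWithin)).exists
    exact ⟨ε, h6, h5.le, h4.le⟩
  obtain ⟨a, g, hg, hcyl⟩ := h.exists_isGraphChart hΩ hx hN hε hε1 he
  have hfin := finrank_orthogonal_span_singleton_euclideanSpace hn hg.norm_eq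
  refine ⟨axisCylinder x e a, isOpen_axisCylinder _ _ _, by simp [axisCylinder, hg.pos], ?_⟩
  intro φ hφ hc hsub
  set H : Measure (EuclideanSpace ℝ (Fin n)) :=
    μHE[n - 1].restrict (frontier Ω ∩ axisCylinder x e a) with hH
  have hmeas : MeasurableSet (frontier Ω ∩ axisCylinder x e a) :=
    isClosed_frontier.measurableSet.inter (isOpen_axisCylinder _ _ _).measurableSet
  have hsubU : tsupport φ ⊆ U := fun y hy => (hcyl (hsub hy)).1
  have hrestrict : ∀ ψ : EuclideanSpace ℝ (Fin n) → ℝ, (∀ y, φ y = 0 → ψ y = 0) →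
      ∫ y in frontier Ω, ψ y ∂μHE[n - 1] = ∫ y, ψ y ∂H := fun ψ hψ =>
    setIntegral_eq_of_subset_of_forall_sdiff_eq_zero isClosed_frontier.measurableSet
      Set.inter_subset_left fun y hy => hψ y
        (image_eq_zero_of_notMem_tsupport fun h' => hy.2 ⟨hy.1, hsub h'⟩)
  -- the field in the direction of the axis
  set W : Set (EuclideanSpace ℝ (Fin n)) := axisCylinder x e a with hW
  have hWo : IsOpen W := isOpen_axisCylinder _ _ _
  have hdρ : ∀ v, ContDiffOn ℝ 1 (fun y => fderiv ℝ ρ y v) W := fun v =>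
    ((h.contDiffOn.fderiv_of_isOpen h.isOpen (by norm_num)).clm_apply contDiffOn_const).mono
      fun y hy => (hcyl hy).1
  have hinv : ContDiffOn ℝ 1 (fun y => (fderiv ℝ ρ y e)⁻¹) W :=
    (hdρ e).inv fun y hy => (hcyl hy).2.1.ne'
  set ψ : EuclideanSpace ℝ (Fin n) → ℝ := fun y => φ y * (fderiv ℝ ρ y e)⁻¹ with hψdef
  have hψ : ContDiffOn ℝ 1 ψ (closure Ω) := hφ.mul_of_tsupport_subset hWo hinv hsub
  have hψsub : tsupport ψ ⊆ tsupport φ := tsupport_mul_subset_left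
  have hψc : HasCompactSupport ψ := hc.mul_right
  have hφψ : φ = fun y => ψ y * fderiv ℝ ρ y e := by
    ext y
    by_cases hy : y ∈ tsupport φ
    · have := (hcyl (hsub hy)).2.1.ne'
      simp only [hψdef]
      field_simp
    · simp only [hψdef, image_eq_zero_of_notMem_tsupport hy, zero_mul]
  have hψw : (fun y => ψ y * fderiv ℝ ρ y w) = fun y => φ y * q y := by
    ext y
    simp only [hψdef, hq]
    ring
  have hφq : ContDiffOn ℝ 1 (fun y => φ y * q y) (closure Ω) :=
    hφ.mul_of_tsupport_subset hWo ((hdρ w).div (hdρ e) fun y hy => (hcyl hy).2.1.ne') hsub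
  have hφqc : HasCompactSupport (fun y => φ y * q y) := hc.mul_right
  have hqH : Integrable (fun y => φ y * q y) H :=
    (hΩ.integrableOn_frontier hn (hφq.continuousOn.mono frontier_subset_closure)
      hφqc).mono_set Set.inter_subset_left
  have hνH : Integrable (fun y => φ y * inner ℝ (outwardNormal Ω y) w) H :=
    (hΩ.integrableOn_frontier_mul_inner hn hφ.continuousOn hc w).mono_set Set.inter_subset_left
  have habsH : Integrable (fun y => |φ y|) H :=
    ((hΩ.integrableOn_frontier hn (hφ.continuousOn.mono frontier_subset_closure)
      hc).mono_set Set.inter_subset_left).abs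
  have hvol : ∫ y in Ω, fderiv ℝ φ y w = ∫ y, φ y * q y ∂(graphMeasure x e a g) := by
    rw [hφψ, setIntegral_fderiv_mul_fderiv_comm hΩ.isOpen hΩ.uniqueDiffOn_closure h.isOpen
      h.contDiffOn h.mem_iff hψ hψc (hψsub.trans hsubU) w e, hψw,
      hg.setIntegral_fderiv hΩ.isOpen hΩ.uniqueDiffOn_closure hφq hφqc
        (tsupport_mul_subset_left.trans hsub), ← hφψ, graphMeasure,
      integral_map hg.aemeasurable (hqH.mono_measure (hg.graphMeasure_le hfin)).aestronglyMeasurable]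
  have hcmp := abs_integral_sub_integral_le_of_le_of_le_smul
    (one_le_pow₀ (by linarith : 1 ≤ 1 + ε)) (hg.graphMeasure_le hfin) (hg.le_graphMeasure hfin) hqH
  rw [← hvol, ← hH] at hcmp
  have hpt : ∀ y ∈ frontier Ω ∩ W, |q y - inner ℝ (outwardNormal Ω y) w| ≤ δ / 2 ∧
      |q y| ≤ ‖w‖ + δ := by
    intro y hy
    have hyN := hcyl hy.2
    have hn := (h.of_mem hyN.1).outwardNormal_eq hΩ hy.1
    have h1 : inner ℝ (outwardNormal Ω y) w = ν y := by rw [hn]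
    have h2 : |ν y| ≤ ‖w‖ := by
      have h3 := norm_pos_iff.2 (h.gradient_ne_zero y hyN.1)
      have h4 := abs_real_inner_le_norm (‖gradient ρ y‖⁻¹ • gradient ρ y) w
      rwa [norm_smul, norm_inv, norm_norm, inv_mul_cancel₀ h3.ne', one_mul] at h4
    rw [h1]
    refine ⟨hyN.2.2.le, ?_⟩
    have h5 := abs_add_le (q y - ν y) (ν y)
    rw [sub_add_cancel] at h5
    linarith [hyN.2.2]
  have h1 : ∫ y, |φ y * q y| ∂H ≤ (‖w‖ + δ) * ∫ y, |φ y| ∂H := by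
    rw [← integral_const_mul]
    refine integral_mono_ae hqH.abs (habsH.const_mul _) ?_
    filter_upwards [ae_restrict_mem hmeas] with y hy
    rw [abs_mul, mul_comm]
    exact mul_le_mul_of_nonneg_right (hpt y hy).2 (abs_nonneg _)
  have h2 : |∫ y, φ y * q y ∂H - ∫ y, φ y * inner ℝ (outwardNormal Ω y) w ∂H| ≤
      δ / 2 * ∫ y, |φ y| ∂H := by
    rw [← integral_sub hqH hνH, ← integral_const_mul]
    refine (abs_integral_le_integral_abs).trans
      (integral_mono_ae (hqH.sub hνH).abs (habsH.const_mul _) ?_)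
    filter_upwards [ae_restrict_mem hmeas] with y hy
    rw [← mul_sub, abs_mul, mul_comm]
    exact mul_le_mul_of_nonneg_right (hpt y hy).1 (abs_nonneg _)
  rw [hrestrict _ fun y hy => by rw [hy, zero_mul], hrestrict _ fun y hy => by rw [hy, abs_zero]]
  have h3 : 0 ≤ ∫ y, |φ y| ∂H := integral_nonneg fun y => abs_nonneg _
  have h4 : ((1 + ε) ^ (n - 1) - 1) * ∫ y, |φ y * q y| ∂H ≤ δ / 2 * ∫ y, |φ y| ∂H := by
    have h5 : 0 ≤ (1 + ε) ^ (n - 1) - 1 := by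
      have := one_le_pow₀ (n := n - 1) (by linarith : 1 ≤ 1 + ε)
      linarith
    calc _ ≤ ((1 + ε) ^ (n - 1) - 1) * ((‖w‖ + δ) * ∫ y, |φ y| ∂H) :=
          mul_le_mul_of_nonneg_left h1 h5
      _ = ((1 + ε) ^ (n - 1) - 1) * (‖w‖ + δ) * ∫ y, |φ y| ∂H := by ring
      _ ≤ _ := mul_le_mul_of_nonneg_right hεδ h3
  rw [abs_sub_comm] at hcmp
  have h5 := abs_sub_le (∫ y in Ω, fderiv ℝ φ y w) (∫ y, φ y * q y ∂H)
    (∫ y, φ y * inner ℝ (outwardNormal Ω y) w ∂H)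
  linarith

/-- Split `φ = φη + φ(1 - η)` with `0 ≤ η ≤ 1`. Then `|φη| + |φ(1 - η)| = |φ|`, so the errors add up
to the same `δ ∫ |φ|`, however many pieces are used. -/
theorem IsAlmostDivergence.union (hn : 1 ≤ n) (hΩ : IsRegularDomain Ω)
    {w : EuclideanSpace ℝ (Fin n)} {δ : ℝ}
    {V V' : Set (EuclideanSpace ℝ (Fin n))} (hV : IsOpen V) (hV' : IsOpen V')
    (h : IsAlmostDivergence Ω w δ V)
    (h' : IsAlmostDivergence Ω w δ V') : IsAlmostDivergence Ω w δ (V ∪ V') := by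
  intro φ hφ hc hsub
  obtain ⟨η, hη0, hη1, hη⟩ := exists_contMDiffMap_zero_one_nhds_of_isClosed
    (modelWithCornersSelf ℝ (EuclideanSpace ℝ (Fin n))) (n := 1) (s := tsupport φ ∩ Vᶜ)
    (t := tsupport φ ∩ V'ᶜ)
    ((isClosed_tsupport φ).inter hV.isClosed_compl) ((isClosed_tsupport φ).inter hV'.isClosed_compl)
    (Set.disjoint_left.2 fun x hx hx' => (hsub hx.1).elim hx.2 hx'.2)
  have hηs : ContDiff ℝ 1 η := η.contMDiff.contDiff
  have hηs' : ContDiff ℝ 1 fun x => 1 - η x := contDiff_const.sub hηs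
  have h1 : ContDiffOn ℝ 1 (fun x => φ x * η x) (closure Ω) := hφ.mul hηs.contDiffOn
  have h2 : ContDiffOn ℝ 1 (fun x => φ x * (1 - η x)) (closure Ω) := hφ.mul hηs'.contDiffOn
  have hc1 : HasCompactSupport fun x => φ x * η x := hc.mul_right
  have hc2 : HasCompactSupport fun x => φ x * (1 - η x) := hc.mul_right
  have hs1 : tsupport (fun x => φ x * η x) ⊆ V := by
    intro x hx
    by_contra hxV
    have hxφ : x ∈ tsupport φ := tsupport_mul_subset_left hx
    have h3 : ∀ᶠ y in 𝓝 x, η y = 0 := hη0.filter_mono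
      (nhds_le_nhdsSet (show x ∈ tsupport φ ∩ Vᶜ from ⟨hxφ, hxV⟩))
    exact notMem_tsupport_iff_eventuallyEq.2 h3 (tsupport_mul_subset_right hx)
  have hs2 : tsupport (fun x => φ x * (1 - η x)) ⊆ V' := by
    intro x hx
    by_contra hxV
    have hxφ : x ∈ tsupport φ := tsupport_mul_subset_left hx
    have h3 : ∀ᶠ y in 𝓝 x, η y = 1 := hη1.filter_mono
      (nhds_le_nhdsSet (show x ∈ tsupport φ ∩ V'ᶜ from ⟨hxφ, hxV⟩))
    have h4 : (fun y => 1 - η y) =ᶠ[𝓝 x] 0 := h3.mono fun y hy => by simp [hy]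
    exact notMem_tsupport_iff_eventuallyEq.2 h4 (tsupport_mul_subset_right hx)
  have e1 := h _ h1 hc1 hs1
  have e2 := h' _ h2 hc2 hs2
  have hdiff : ∀ x ∈ Ω, fderiv ℝ φ x w = fderiv ℝ (fun x => φ x * η x) x w +
      fderiv ℝ (fun x => φ x * (1 - η x)) x w := by
    intro x hx
    have hnhds := mem_of_superset (hΩ.isOpen.mem_nhds hx) subset_closure
    have d1 := ((h1 x (subset_closure hx)).contDiffAt hnhds).differentiableAt one_ne_zero
    have d2 := ((h2 x (subset_closure hx)).contDiffAt hnhds).differentiableAt one_ne_zero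
    rw [← add_apply, ← fderiv_fun_add d1 d2]
    congr 2
    ext y
    ring
  have i1 := integrableOn_fderiv_of_contDiffOn_closure (μ := volume) hΩ.isOpen
    hΩ.uniqueDiffOn_closure h1 hc1 w
  have i2 := integrableOn_fderiv_of_contDiffOn_closure (μ := volume) hΩ.isOpen
    hΩ.uniqueDiffOn_closure h2 hc2 w
  have j1 := hΩ.integrableOn_frontier_mul_inner hn h1.continuousOn hc1 w
  have j2 := hΩ.integrableOn_frontier_mul_inner hn h2.continuousOn hc2 w
  have k1 := (hΩ.integrableOn_frontier hn (h1.continuousOn.mono frontier_subset_closure) hc1).abs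
  have k2 := (hΩ.integrableOn_frontier hn (h2.continuousOn.mono frontier_subset_closure) hc2).abs
  rw [setIntegral_congr_fun hΩ.isOpen.measurableSet hdiff, integral_add i1 i2]
  have s1 : ∫ x in frontier Ω, φ x * inner ℝ (outwardNormal Ω x) w ∂μHE[n - 1] =
      (∫ x in frontier Ω, (φ x * η x) * inner ℝ (outwardNormal Ω x) w ∂μHE[n - 1]) +
      ∫ x in frontier Ω, (φ x * (1 - η x)) * inner ℝ (outwardNormal Ω x) w ∂μHE[n - 1] := by
    rw [← integral_add j1 j2]
    congr 1
    ext x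
    ring
  have s2 : ∫ x in frontier Ω, |φ x| ∂μHE[n - 1] =
      (∫ x in frontier Ω, |φ x * η x| ∂μHE[n - 1]) +
      ∫ x in frontier Ω, |φ x * (1 - η x)| ∂μHE[n - 1] := by
    rw [← integral_add k1 k2]
    congr 1
    ext x
    rw [abs_mul, abs_mul, abs_of_nonneg (hη x).1, abs_of_nonneg (sub_nonneg.2 (hη x).2)]
    ring
  rw [s1, s2, mul_add, add_sub_add_comm]
  exact (abs_add_le _ _).trans (add_le_add e1 e2)

/-- The divergence theorem for the field `φ w`. -/
theorem IsRegularDomain.setIntegral_fderiv_eq (hn : 1 ≤ n) (hΩ : IsRegularDomain Ω)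
    {φ : EuclideanSpace ℝ (Fin n) → ℝ} (hφ : ContDiffOn ℝ 1 φ (closure Ω))
    (hc : HasCompactSupport φ) (w : EuclideanSpace ℝ (Fin n)) :
    ∫ x in Ω, fderiv ℝ φ x w =
      ∫ x in frontier Ω, φ x * inner ℝ (outwardNormal Ω x) w ∂μHE[n - 1] := by
  have key : ∀ δ : ℝ, 0 < δ → |(∫ x in Ω, fderiv ℝ φ x w) -
      ∫ x in frontier Ω, φ x * inner ℝ (outwardNormal Ω x) w ∂μHE[n - 1]|
      ≤ δ * ∫ x in frontier Ω, |φ x| ∂μHE[n - 1] := by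
    intro δ hδ
    -- Stability under unions with the same `δ` lets compactness reduce the claim to neighbourhoods
    -- of single points: interior, exterior or boundary.
    obtain ⟨V, hV, hsub, h⟩ : ∃ V, IsOpen V ∧ tsupport φ ⊆ V ∧ IsAlmostDivergence Ω w δ V := by
      refine hc.isCompact.induction_on (p := fun s => ∃ V, IsOpen V ∧ s ⊆ V ∧
        IsAlmostDivergence Ω w δ V) ?_ ?_ ?_ ?_
      · exact ⟨Ω, hΩ.isOpen, Set.empty_subset _, isAlmostDivergence_of_isOpen hΩ.isOpen w δ⟩
      · rintro s t hst ⟨V, hV, htV, h⟩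
        exact ⟨V, hV, hst.trans htV, h⟩
      · rintro s t ⟨V, hV, hsV, h⟩ ⟨V', hV', htV', h'⟩
        exact ⟨V ∪ V', hV.union hV', Set.union_subset_union hsV htV', h.union hn hΩ hV hV' h'⟩
      · intro x _
        have hex : ∃ V, IsOpen V ∧ x ∈ V ∧ IsAlmostDivergence Ω w δ V := by
          by_cases hx : x ∈ closure Ω
          · rw [closure_eq_self_union_frontier] at hx
            rcases hx with hx | hx
            · exact ⟨Ω, hΩ.isOpen, hx, isAlmostDivergence_of_isOpen hΩ.isOpen w δ⟩
            · exact hΩ.exists_isAlmostDivergence hn hx w hδ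
          · exact ⟨_, isClosed_closure.isOpen_compl, hx,
              isAlmostDivergence_compl_closure w δ⟩
        obtain ⟨V, hV, hxV, h⟩ := hex
        exact ⟨V, mem_nhdsWithin_of_mem_nhds (hV.mem_nhds hxV), V, hV, subset_rfl, h⟩
    exact h φ hφ hc hsub
  have hlim : Tendsto (fun δ : ℝ => δ * ∫ x in frontier Ω, |φ x| ∂μHE[n - 1]) (𝓝[>] 0) (𝓝 0) := by
    have h1 : Continuous fun δ : ℝ => δ * ∫ x in frontier Ω, |φ x| ∂μHE[n - 1] := by fun_prop
    have h2 := h1.tendsto 0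
    rw [zero_mul] at h2
    exact h2.mono_left nhdsWithin_le_nhds
  have h0 := ge_of_tendsto hlim (by filter_upwards [self_mem_nhdsWithin] with δ hδ using key δ hδ)
  exact sub_eq_zero.1 (abs_nonpos_iff.1 h0)

end Divergence

/-! ### Properties of the cut-off functions. -/

section Cutoff

variable {n : ℕ} {χ : ℝ → ℝ}

theorem IsCutoffProfile.abs_sub_le (hχ : IsCutoffProfile χ) {s t : ℝ} (hs : 0 ≤ s) (ht : 0 ≤ t) :
    |χ s - χ t| ≤ 2 * |s - t| :=
  Convex.norm_image_sub_le_of_norm_deriv_le (s := Set.Ici 0)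
    (fun x _ => (hχ.contDiff.differentiable (by simp)) x)
    (fun x hx => hχ.abs_deriv_le x hx) (convex_Ici 0) ht hs

/-- The profile is not assumed monotone or at most `1`; starting from `χ 0 = 1` with slope at most
`2` on `[0, 2]` gives `1 + 2·2`. -/
theorem IsCutoffProfile.le_five (hχ : IsCutoffProfile χ) {s : ℝ} (hs : 0 ≤ s) : χ s ≤ 5 := by
  by_cases h2 : 2 ≤ s
  · rw [hχ.eq_zero s h2]
    norm_num
  · have h := hχ.abs_sub_le hs le_rfl
    rw [hχ.eq_one 0 le_rfl zero_le_one, sub_zero, abs_of_nonneg hs] at h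
    linarith [(abs_le.1 h).2, not_le.1 h2]

theorem cutoff_eq_one (hχ : IsCutoffProfile χ) {R : ℝ} (hR : 0 < R)
    {x : EuclideanSpace ℝ (Fin n)} (hx : ‖x‖ ≤ R) : cutoff χ R x = 1 :=
  hχ.eq_one _ (by positivity) ((div_le_one hR).2 hx)

theorem cutoff_eq_zero (hχ : IsCutoffProfile χ) {R : ℝ} (hR : 0 < R)
    {x : EuclideanSpace ℝ (Fin n)} (hx : 2 * R ≤ ‖x‖) : cutoff χ R x = 0 :=
  hχ.eq_zero _ ((le_div_iff₀ hR).2 hx)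

theorem cutoff_nonneg (hχ : IsCutoffProfile χ) {R : ℝ} (hR : 0 < R)
    (x : EuclideanSpace ℝ (Fin n)) : 0 ≤ cutoff χ R x := hχ.nonneg _ (by positivity)

theorem cutoff_le_five (hχ : IsCutoffProfile χ) {R : ℝ} (hR : 0 < R)
    (x : EuclideanSpace ℝ (Fin n)) : cutoff χ R x ≤ 5 := hχ.le_five (by positivity)

theorem cutoff_eventuallyEq_one (hχ : IsCutoffProfile χ) {R : ℝ} (hR : 0 < R)
    {x : EuclideanSpace ℝ (Fin n)} (hx : ‖x‖ < R) : cutoff χ R =ᶠ[𝓝 x] fun _ => 1 := by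
  filter_upwards [continuous_norm.continuousAt.eventually_lt_const hx] with y hy
  exact cutoff_eq_one hχ hR hy.le

/-- The norm is singular only at the origin, around which the cut-off is constant. -/
theorem contDiff_cutoff (hχ : IsCutoffProfile χ) {R : ℝ} (hR : 0 < R) :
    ContDiff ℝ 1 (cutoff χ R : EuclideanSpace ℝ (Fin n) → ℝ) := by
  rw [contDiff_iff_contDiffAt]
  intro x
  by_cases hx : ‖x‖ < R
  · exact contDiffAt_const.congr_of_eventuallyEq (cutoff_eventuallyEq_one hχ hR hx)
  · have hx0 : x ≠ 0 := by
      rintro rfl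
      exact hx (by simpa using hR)
    exact (hχ.contDiff.of_le (by simp)).contDiffAt.comp x
      ((contDiffAt_norm ℝ hx0).div_const R)

theorem hasCompactSupport_cutoff (hχ : IsCutoffProfile χ) {R : ℝ} (hR : 0 < R) :
    HasCompactSupport (cutoff χ R : EuclideanSpace ℝ (Fin n) → ℝ) := by
  refine HasCompactSupport.intro (isCompact_closedBall 0 (2 * R)) fun x hx => ?_
  rw [mem_closedBall_zero_iff, not_le] at hx
  exact cutoff_eq_zero hχ hR hx.le

theorem norm_fderiv_cutoff_le (hχ : IsCutoffProfile χ) {R : ℝ} (hR : 0 < R)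
    (x : EuclideanSpace ℝ (Fin n)) : ‖fderiv ℝ (cutoff χ R) x‖ ≤ 2 / R := by
  refine norm_fderiv_le_of_lip' ℝ (by positivity) (Eventually.of_forall fun y => ?_)
  refine (hχ.abs_sub_le (by positivity) (by positivity)).trans ?_
  rw [← sub_div, abs_div, abs_of_pos hR, ← mul_div_assoc, div_mul_eq_mul_div]
  gcongr
  exact abs_norm_sub_norm_le _ _

theorem fderiv_cutoff_eq_zero (hχ : IsCutoffProfile χ) {R : ℝ} (hR : 0 < R)
    {x : EuclideanSpace ℝ (Fin n)} (hx : ‖x‖ < R) : fderiv ℝ (cutoff χ R) x = 0 := by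
  rw [(cutoff_eventuallyEq_one hχ hR hx).fderiv_eq]
  simp

end Cutoff

/-! ### The field `φ ∇(v/φ)` and the pointwise divergence computation. -/

section Energy

variable {n : ℕ} {Ω : Set (EuclideanSpace ℝ (Fin n))} {v φ : EuclideanSpace ℝ (Fin n) → ℝ}

/-- The field `φ ∇(v/φ) = ∇v - (v/φ) ∇φ` on `closure Ω`. -/
noncomputable def quotientField (Ω : Set (EuclideanSpace ℝ (Fin n)))
    (v φ : EuclideanSpace ℝ (Fin n) → ℝ) (x : EuclideanSpace ℝ (Fin n)) :
    EuclideanSpace ℝ (Fin n) :=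
  WithLp.toLp 2 fun i => fderivWithin ℝ v (closure Ω) x (EuclideanSpace.single i 1) -
    v x / φ x * fderivWithin ℝ φ (closure Ω) x (EuclideanSpace.single i 1)

theorem EuclideanSpace.sum_smul_single (w : EuclideanSpace ℝ (Fin n)) :
    ∑ i, w i • EuclideanSpace.single i (1 : ℝ) = w := by
  have := (EuclideanSpace.basisFun (Fin n) ℝ).sum_repr w
  simpa using this

theorem EuclideanSpace.sum_mul_map_single (L : EuclideanSpace ℝ (Fin n) →L[ℝ] ℝ)
    (w : EuclideanSpace ℝ (Fin n)) :
    ∑ i, w i * L (EuclideanSpace.single i 1) = L w := by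
  conv_rhs => rw [← EuclideanSpace.sum_smul_single w, map_sum]
  simp

theorem ContDiffAt.laplacian_eq_sum {x : EuclideanSpace ℝ (Fin n)} (hv : ContDiffAt ℝ 2 v x) :
    Laplacian.laplacian v x = ∑ i, fderiv ℝ (fun y => fderiv ℝ v y (EuclideanSpace.single i 1)) x
      (EuclideanSpace.single i 1) := by
  rw [InnerProductSpace.laplacian_eq_iteratedFDeriv_orthonormalBasis v
    (EuclideanSpace.basisFun (Fin n) ℝ)]
  refine Finset.sum_congr rfl fun i _ => ?_
  have h1 : DifferentiableAt ℝ (fderiv ℝ v) x :=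
    (hv.fderiv_right (m := 1) (by norm_num)).differentiableAt one_ne_zero
  rw [iteratedFDeriv_two_apply, fderiv_clm_apply h1 (differentiableAt_const _)]
  simp

theorem contDiffOn_quotientField (hd : UniqueDiffOn ℝ (closure Ω))
    (hv : ContDiffOn ℝ 2 v (closure Ω)) (hφ : ContDiffOn ℝ 2 φ (closure Ω))
    (hpos : ∀ x ∈ closure Ω, 0 < φ x) (i : Fin n) :
    ContDiffOn ℝ 1 (fun x => quotientField Ω v φ x i) (closure Ω) := by
  have h1 : ∀ {w : EuclideanSpace ℝ (Fin n) → ℝ}, ContDiffOn ℝ 2 w (closure Ω) →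
      ContDiffOn ℝ 1 (fun x => fderivWithin ℝ w (closure Ω) x (EuclideanSpace.single i 1))
        (closure Ω) := fun hw =>
    (hw.fderivWithin hd (by norm_num)).clm_apply contDiffOn_const
  exact (h1 hv).sub (((hv.of_le one_le_two).div (hφ.of_le one_le_two)
    fun x hx => (hpos x hx).ne').mul (h1 hφ))

theorem inner_quotientField (x w : EuclideanSpace ℝ (Fin n)) :
    inner ℝ w (quotientField Ω v φ x) =
      fderivWithin ℝ v (closure Ω) x w - v x / φ x * fderivWithin ℝ φ (closure Ω) x w := by
  rw [← EuclideanSpace.sum_mul_map_single (fderivWithin ℝ v (closure Ω) x),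
    ← EuclideanSpace.sum_mul_map_single (fderivWithin ℝ φ (closure Ω) x), Finset.mul_sum,
    ← Finset.sum_sub_distrib, PiLp.inner_apply]
  refine Finset.sum_congr rfl fun i _ => ?_
  simp only [quotientField, RCLike.inner_apply, conj_trivial]
  ring

/-- The derivative of a flux `c² v (v_i - (v/φ) φ_i)`. -/
theorem fderiv_flux_apply {E : Type*} [NormedAddCommGroup E] [NormedSpace ℝ E]
    {c v p vi pi : E → ℝ} {x b : E} (hc : DifferentiableAt ℝ c x) (hv : DifferentiableAt ℝ v x)
    (hp : DifferentiableAt ℝ p x) (hvi : DifferentiableAt ℝ vi x) (hpi : DifferentiableAt ℝ pi x)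
    (hp0 : p x ≠ 0) (h1 : fderiv ℝ v x b = vi x) (h2 : fderiv ℝ p x b = pi x) :
    fderiv ℝ (fun y => c y ^ 2 * (v y * (vi y - v y / p y * pi y))) x b =
      2 * c x * fderiv ℝ c x b * v x * (vi x - v x / p x * pi x) +
      c x ^ 2 * ((vi x - v x / p x * pi x) ^ 2 + v x * fderiv ℝ vi x b -
        v x ^ 2 / p x * fderiv ℝ pi x b) := by
  have hline : ∀ {w : E → ℝ}, DifferentiableAt ℝ w x →
      HasDerivAt (fun t : ℝ => w (x + t • b)) (fderiv ℝ w x b) 0 := by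
    intro w hw
    have h3 : HasDerivAt (fun t : ℝ => x + t • b) b 0 := by
      simpa using ((hasDerivAt_id (0 : ℝ)).smul_const b).const_add x
    have h4 : HasFDerivAt w (fderiv ℝ w x) (x + (0 : ℝ) • b) := by simpa using hw.hasFDerivAt
    exact h4.comp_hasDerivAt (0 : ℝ) h3
  have hdiv : DifferentiableAt ℝ (fun y => v y / p y) x := by
    simp only [div_eq_mul_inv]
    exact hv.mul (hp.fun_inv hp0)
  have hF : DifferentiableAt ℝ (fun y => c y ^ 2 * (v y * (vi y - v y / p y * pi y))) x :=
    (hc.pow 2).mul (hv.mul (hvi.sub ((hdiv.mul hpi))))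
  have hp0' : p (x + (0 : ℝ) • b) ≠ 0 := by simpa using hp0
  have hR := ((hline hc).pow 2).mul ((hline hv).mul
    ((hline hvi).sub (((hline hv).div (hline hp) hp0').mul (hline hpi))))
  -- With `z = v_i - (v/p) p_i`, the derivative of `v/p` is `z/p`, so the first-order terms `v_i z -
  -- (v/p) p_i z` combine into `z²`.
  rw [(hline hF).unique hR]
  simp only [zero_smul, add_zero, h1, h2, Pi.pow_apply, Pi.mul_apply, Pi.sub_apply, Pi.div_apply]
  field_simp
  push_cast
  ring

end Energy

/-! ### The cut-off energy estimate and its consequences. -/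

section Liouville

variable {n : ℕ} {Ω : Set (EuclideanSpace ℝ (Fin n))} {v φ : EuclideanSpace ℝ (Fin n) → ℝ}

/-- The field `c² v φ ∇(v/φ)`, component by component. -/
noncomputable def cutoffFlux (Ω : Set (EuclideanSpace ℝ (Fin n)))
    (c v φ : EuclideanSpace ℝ (Fin n) → ℝ) (i : Fin n) (x : EuclideanSpace ℝ (Fin n)) : ℝ :=
  c x ^ 2 * (v x * quotientField Ω v φ x i)

theorem sum_fderiv_cutoffFlux (hΩ : IsOpen Ω) {c : EuclideanSpace ℝ (Fin n) → ℝ}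
    (hc : ContDiff ℝ 1 c) (hv : ContDiffOn ℝ 2 v (closure Ω)) (hφ : ContDiffOn ℝ 2 φ (closure Ω))
    (hpos : ∀ x ∈ closure Ω, 0 < φ x) {x : EuclideanSpace ℝ (Fin n)} (hx : x ∈ Ω) :
    ∑ i, fderiv ℝ (cutoffFlux Ω c v φ i) x (EuclideanSpace.single i 1) =
      2 * c x * v x * fderiv ℝ c x (quotientField Ω v φ x) +
      c x ^ 2 * (‖quotientField Ω v φ x‖ ^ 2 + v x * Laplacian.laplacian v x -
        v x ^ 2 / φ x * Laplacian.laplacian φ x) := by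
  have hnhds := mem_of_superset (hΩ.mem_nhds hx) (subset_closure (s := Ω))
  have hvx : ContDiffAt ℝ 2 v x := (hv x (subset_closure hx)).contDiffAt hnhds
  have hφx : ContDiffAt ℝ 2 φ x := (hφ x (subset_closure hx)).contDiffAt hnhds
  have hd : ∀ {w : EuclideanSpace ℝ (Fin n) → ℝ}, ContDiffAt ℝ 2 w x → ∀ i : Fin n,
      DifferentiableAt ℝ (fun y => fderiv ℝ w y (EuclideanSpace.single i 1)) x := fun hw i =>
    ((hw.fderiv_right (m := 1) (by norm_num)).clm_apply contDiffAt_const).differentiableAt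
      one_ne_zero
  have hcomp : ∀ y ∈ Ω, ∀ i, quotientField Ω v φ y i =
      fderiv ℝ v y (EuclideanSpace.single i 1) -
        v y / φ y * fderiv ℝ φ y (EuclideanSpace.single i 1) := by
    intro y hy i
    simp only [quotientField, fderivWithin_closure_eq_fderiv hΩ _ hy]
  have hterm : ∀ i, fderiv ℝ (cutoffFlux Ω c v φ i) x (EuclideanSpace.single i 1) =
      2 * c x * v x * (quotientField Ω v φ x i * fderiv ℝ c x (EuclideanSpace.single i 1)) +
      c x ^ 2 * (quotientField Ω v φ x i ^ 2 + v x * fderiv ℝ (fun y => fderiv ℝ v y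
        (EuclideanSpace.single i 1)) x (EuclideanSpace.single i 1) -
        v x ^ 2 / φ x * fderiv ℝ (fun y => fderiv ℝ φ y
          (EuclideanSpace.single i 1)) x (EuclideanSpace.single i 1)) := by
    intro i
    have hloc : cutoffFlux Ω c v φ i =ᶠ[𝓝 x] fun y => c y ^ 2 * (v y *
        (fderiv ℝ v y (EuclideanSpace.single i 1) -
          v y / φ y * fderiv ℝ φ y (EuclideanSpace.single i 1))) := by
      filter_upwards [hΩ.mem_nhds hx] with y hy
      rw [cutoffFlux, hcomp y hy]
    rw [hloc.fderiv_eq, fderiv_flux_apply (hc.differentiable one_ne_zero x)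
      (hvx.differentiableAt two_ne_zero) (hφx.differentiableAt two_ne_zero) (hd hvx i) (hd hφx i)
      (hpos x (subset_closure hx)).ne' rfl rfl, hcomp x hx]
    ring
  rw [Finset.sum_congr rfl fun i _ => hterm i, Finset.sum_add_distrib, ← Finset.mul_sum,
    ← Finset.mul_sum, Finset.sum_sub_distrib, Finset.sum_add_distrib, ← Finset.mul_sum,
    ← Finset.mul_sum, EuclideanSpace.sum_mul_map_single, ← hvx.laplacian_eq_sum,
    ← hφx.laplacian_eq_sum, EuclideanSpace.real_norm_sq_eq]

/-- The Neumann condition on `φ` removes the `∇φ` part of the normal flux, leaving `c² v ∂_ν v`, and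
`v ∂_ν v = ½ ∂_ν (v²)`. -/
theorem IsRegularDomain.integral_sum_fderiv_cutoffFlux (hn : 1 ≤ n) (hΩ : IsRegularDomain Ω)
    {c : EuclideanSpace ℝ (Fin n) → ℝ} (hc : ContDiff ℝ 1 c) (hcc : HasCompactSupport c)
    (hv : ContDiffOn ℝ 2 v (closure Ω)) (hφ : ContDiffOn ℝ 2 φ (closure Ω))
    (hpos : ∀ x ∈ closure Ω, 0 < φ x) (hneu : ∀ x ∈ frontier Ω, normalDeriv Ω φ x = 0) :
    IntegrableOn (fun x => ∑ i, fderiv ℝ (cutoffFlux Ω c v φ i) x (EuclideanSpace.single i 1)) Ω ∧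
    ∫ x in Ω, ∑ i, fderiv ℝ (cutoffFlux Ω c v φ i) x (EuclideanSpace.single i 1) =
      2⁻¹ * surfaceIntegral Ω (fun x => c x ^ 2 * normalDeriv Ω (fun y => v y ^ 2) x) := by
  have hd := hΩ.uniqueDiffOn_closure
  have hF : ∀ i, ContDiffOn ℝ 1 (cutoffFlux Ω c v φ i) (closure Ω) := fun i =>
    (hc.contDiffOn.pow 2).mul ((hv.of_le one_le_two).mul (contDiffOn_quotientField hd hv hφ hpos i))
  have hFc : ∀ i, HasCompactSupport (cutoffFlux Ω c v φ i) := fun i => by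
    refine HasCompactSupport.intro hcc.isCompact fun x hx => ?_
    rw [cutoffFlux, image_eq_zero_of_notMem_tsupport hx]
    ring
  have hint : ∀ i, IntegrableOn (fun x => fderiv ℝ (cutoffFlux Ω c v φ i) x
      (EuclideanSpace.single i 1)) Ω := fun i =>
    integrableOn_fderiv_of_contDiffOn_closure hΩ.isOpen hd (hF i) (hFc i) _
  refine ⟨integrable_finsetSum _ fun i _ => hint i, ?_⟩
  rw [integral_finsetSum _ fun i _ => hint i, surfaceIntegral, ← integral_const_mul,
    Finset.sum_congr rfl fun i _ => hΩ.setIntegral_fderiv_eq hn (hF i) (hFc i) _,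
    ← integral_finsetSum _ fun i _ =>
      hΩ.integrableOn_frontier_mul_inner hn (hF i).continuousOn (hFc i) _]
  refine setIntegral_congr_fun isClosed_frontier.measurableSet fun x hx => ?_
  have hxc := frontier_subset_closure hx
  have h1 : normalDeriv Ω (fun y => v y ^ 2) x = 2 * v x * normalDeriv Ω v x := by
    have h2 : DifferentiableWithinAt ℝ v (closure Ω) x :=
      (hv x hxc).differentiableWithinAt two_ne_zero
    rw [normalDeriv, (h2.hasFDerivWithinAt.pow 2).fderivWithin (hd x hxc), normalDeriv]
    simp
  have h3 : normalDeriv Ω v x = inner ℝ (outwardNormal Ω x) (quotientField Ω v φ x) := by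
    have h4 := hneu x hx
    rw [normalDeriv] at h4
    rw [inner_quotientField, h4, normalDeriv]
    ring
  simp only [h1, h3, cutoffFlux]
  rw [PiLp.inner_apply, Finset.mul_sum, Finset.mul_sum, Finset.mul_sum]
  refine Finset.sum_congr rfl fun i _ => ?_
  simp [EuclideanSpace.inner_single_right]
  ring

/-- Young's inequality, from the square `t⁻¹ (t|c|b - k)²`. The weight stays free because it is
taken small once and later sent to infinity. -/
theorem young_cutoff {c a b k t : ℝ} (ht : 0 < t) (h : |a| ≤ k * b) :
    -(2 * c * a) ≤ t * (c ^ 2 * b ^ 2) + t⁻¹ * k ^ 2 := by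
  have h1 : -(2 * c * a) ≤ 2 * |c| * |a| := by
    have := neg_abs_le (c * a)
    rw [abs_mul] at this
    linarith
  have h2 : 2 * |c| * |a| ≤ 2 * |c| * (k * b) := mul_le_mul_of_nonneg_left h (by positivity)
  have h3 : t * (c ^ 2 * b ^ 2) + t⁻¹ * k ^ 2 - 2 * |c| * (k * b) = t⁻¹ * (t * |c| * b - k) ^ 2 := by
    rw [← sq_abs c]
    field_simp
    ring
  have h4 : 0 ≤ t⁻¹ * (t * |c| * b - k) ^ 2 := by positivity
  linarith

/-- The Caccioppoli-type estimate for `φ ∇(v/φ)`. -/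
theorem IsRegularDomain.integral_cutoff_sq_mul_le (hn : 1 ≤ n) (hΩ : IsRegularDomain Ω)
    {χ : ℝ → ℝ} (hχ : IsCutoffProfile χ) {R : ℝ} (hR : 0 < R)
    (hv : ContDiffOn ℝ 2 v (closure Ω)) (hφ : ContDiffOn ℝ 2 φ (closure Ω))
    (hpos : ∀ x ∈ closure Ω, 0 < φ x) (hneu : ∀ x ∈ frontier Ω, normalDeriv Ω φ x = 0)
    {M : ℝ} (hM : ∀ x ∈ Ω, |v x| ≤ M)
    (hsub : ∀ x ∈ Ω, 0 ≤ v x * Laplacian.laplacian v x - v x ^ 2 / φ x * Laplacian.laplacian φ x)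
    (hbdry : surfaceIntegral Ω
      (fun x => (cutoff χ R x) ^ 2 * normalDeriv Ω (fun y => (v y) ^ 2) x) ≤ 0)
    {t : ℝ} (ht : 0 < t) :
    IntegrableOn (fun x => cutoff χ R x ^ 2 * ‖quotientField Ω v φ x‖ ^ 2) Ω ∧
    ∫ x in Ω, cutoff χ R x ^ 2 * ‖quotientField Ω v φ x‖ ^ 2 ≤
      t * (∫ x in Ω ∩ (Metric.ball 0 R)ᶜ, cutoff χ R x ^ 2 * ‖quotientField Ω v φ x‖ ^ 2) +
      t⁻¹ * ((2 * M / R) ^ 2 * volume.real (Ω ∩ {x | ‖x‖ ≤ 2 * R})) := by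
  set c : EuclideanSpace ℝ (Fin n) → ℝ := cutoff χ R with hc
  set Z := quotientField Ω v φ with hZ
  have hc1 : ContDiff ℝ 1 c := contDiff_cutoff hχ hR
  have hcc : HasCompactSupport c := hasCompactSupport_cutoff hχ hR
  have hd := hΩ.uniqueDiffOn_closure
  have hmΩ := hΩ.isOpen.measurableSet
  obtain ⟨hdi, hdiv⟩ := hΩ.integral_sum_fderiv_cutoffFlux hn hc1 hcc hv hφ hpos hneu
  have hZc : ContinuousOn (fun x => ‖Z x‖ ^ 2) (closure Ω) := by
    simp only [EuclideanSpace.real_norm_sq_eq]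
    exact continuousOn_finsetSum _ fun i _ =>
      (contDiffOn_quotientField hd hv hφ hpos i).continuousOn.pow 2
  have hI : IntegrableOn (fun x => c x ^ 2 * ‖Z x‖ ^ 2) Ω := by
    refine ((hc1.continuous.continuousOn.pow 2).mul hZc).integrableOn_of_hasCompactSupport
      isClosed_closure hmΩ subset_closure ?_ ?_
    · refine HasCompactSupport.intro hcc.isCompact fun x hx => ?_
      simp [image_eq_zero_of_notMem_tsupport hx]
    · refine ((measure_mono Set.inter_subset_left).trans_lt (IsCompact.measure_lt_top ?_)).ne
      refine hcc.isCompact.of_isClosed_subset (isClosed_tsupport _) (closure_mono fun x hx => ?_)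
      contrapose! hx
      simp [Function.notMem_support.1 hx]
  refine ⟨hI, ?_⟩
  set S : Set (EuclideanSpace ℝ (Fin n)) := (Metric.ball 0 R)ᶜ with hS
  set T : Set (EuclideanSpace ℝ (Fin n)) := {x | ‖x‖ ≤ 2 * R} with hT
  have hmS : MeasurableSet S := Metric.isOpen_ball.measurableSet.compl
  have hmT : MeasurableSet T := (isClosed_le continuous_norm continuous_const).measurableSet
  have hfin : volume (Ω ∩ T) ≠ ⊤ := by
    have h1 : T = Metric.closedBall 0 (2 * R) := by ext x; simp [hT]
    exact ((measure_mono Set.inter_subset_right).trans_lt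
      (h1 ▸ measure_closedBall_lt_top)).ne
  -- The cross term vanishes unless `R ≤ |x| < 2R`, so the energy part of Young's inequality may be
  -- restricted to `S` and the constant part to `T`. Restricting to `S` is what later makes it a
  -- vanishing tail.
  have hpt : ∀ x ∈ Ω, c x ^ 2 * ‖Z x‖ ^ 2 -
      (t * S.indicator (fun x => c x ^ 2 * ‖Z x‖ ^ 2) x +
        t⁻¹ * T.indicator (fun _ => (2 * M / R) ^ 2) x) ≤
      ∑ i, fderiv ℝ (cutoffFlux Ω c v φ i) x (EuclideanSpace.single i 1) := by
    intro x hx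
    rw [sum_fderiv_cutoffFlux hΩ.isOpen hc1 hv hφ hpos hx, ← hZ]
    have h1 := mul_nonneg (sq_nonneg (c x)) (hsub x hx)
    have h2 : -(2 * c x * (v x * fderiv ℝ c x (Z x))) ≤
        t * S.indicator (fun x => c x ^ 2 * ‖Z x‖ ^ 2) x +
        t⁻¹ * T.indicator (fun _ => (2 * M / R) ^ 2) x := by
      have hSn : 0 ≤ t * S.indicator (fun x => c x ^ 2 * ‖Z x‖ ^ 2) x :=
        mul_nonneg ht.le (Set.indicator_nonneg (fun y _ => by positivity) x)
      have hTn : 0 ≤ t⁻¹ * T.indicator (fun _ => (2 * M / R) ^ 2) x :=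
        mul_nonneg (inv_nonneg.2 ht.le) (Set.indicator_nonneg (fun y _ => by positivity) x)
      by_cases hxR : ‖x‖ < R
      · rw [hc, fderiv_cutoff_eq_zero hχ hR hxR]
        simp only [zero_apply, mul_zero, neg_zero]
        exact add_nonneg hSn hTn
      by_cases hxR2 : 2 * R ≤ ‖x‖
      · rw [hc] at hSn ⊢
        rw [cutoff_eq_zero hχ hR hxR2]
        simp only [mul_zero, zero_mul, neg_zero]
        exact add_nonneg hSn hTn
      have hxS : x ∈ S := by simpa [hS] using hxR
      have hxT : x ∈ T := (not_le.1 hxR2).le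
      rw [Set.indicator_of_mem hxS, Set.indicator_of_mem hxT]
      refine young_cutoff ht ?_
      have h3 := (fderiv ℝ c x).le_opNorm (Z x)
      rw [Real.norm_eq_abs] at h3
      rw [abs_mul]
      have h4 := norm_fderiv_cutoff_le hχ hR x
      have hM0 : 0 ≤ M := (abs_nonneg _).trans (hM x hx)
      calc |v x| * |fderiv ℝ c x (Z x)| ≤ M * (2 / R * ‖Z x‖) :=
            mul_le_mul (hM x hx) (h3.trans (mul_le_mul_of_nonneg_right h4 (norm_nonneg _)))
              (abs_nonneg _) hM0
        _ = 2 * M / R * ‖Z x‖ := by ring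
    nlinarith
  have hIS : IntegrableOn (S.indicator fun x => c x ^ 2 * ‖Z x‖ ^ 2) Ω := hI.indicator hmS
  have hIT : IntegrableOn (T.indicator fun _ => (2 * M / R) ^ 2) Ω := by
    rw [IntegrableOn, integrable_indicator_iff hmT, IntegrableOn, Measure.restrict_restrict hmT,
      Set.inter_comm]
    exact integrableOn_const hfin
  have hsum : IntegrableOn (fun x => t * S.indicator (fun x => c x ^ 2 * ‖Z x‖ ^ 2) x +
      t⁻¹ * T.indicator (fun _ => (2 * M / R) ^ 2) x) Ω :=
    (hIS.const_mul t).add (hIT.const_mul t⁻¹)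
  have hle := setIntegral_mono_on (hI.sub hsum) hdi hmΩ hpt
  rw [hdiv] at hle
  simp only [Pi.sub_apply] at hle
  rw [integral_sub hI hsum,
    integral_add (hIS.const_mul t) (hIT.const_mul t⁻¹), integral_const_mul, integral_const_mul,
    setIntegral_indicator hmS, setIntegral_indicator hmT, setIntegral_const, smul_eq_mul] at hle
  linarith

theorem HasQuadraticGrowth.exists_volume_le (h : HasQuadraticGrowth Ω) :
    ∃ C : ℝ, 0 ≤ C ∧ ∀ᶠ R : ℝ in atTop, volume.real (Ω ∩ {x | ‖x‖ ≤ R}) ≤ C * R ^ 2 := by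
  obtain ⟨C, hC, -⟩ := ENNReal.lt_iff_exists_nnreal_btwn.1 h
  refine ⟨C, C.2, ?_⟩
  filter_upwards [eventually_lt_of_limsup_lt hC, eventually_gt_atTop 0] with R hR hR0
  have h1 : ENNReal.ofReal (R ^ 2) ≠ 0 := by simpa using by positivity
  have h2 := (ENNReal.div_le_iff h1 ENNReal.ofReal_ne_top).1 hR.le
  have h3 := ENNReal.toReal_mono (ENNReal.mul_ne_top ENNReal.coe_ne_top ENNReal.ofReal_ne_top) h2
  rwa [ENNReal.toReal_mul, ENNReal.toReal_ofReal (by positivity)] at h3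

/-- A nonnegative function whose cut-off integrals satisfy a Caccioppoli-type estimate with a
bounded remainder has zero integral. -/
theorem integral_eq_zero_of_cutoff_estimate {χ : ℝ → ℝ} (hχ : IsCutoffProfile χ)
    {h : EuclideanSpace ℝ (Fin n) → ℝ} (h0 : ∀ x, 0 ≤ h x)
    (hint : ∀ R : ℝ, 1 < R → IntegrableOn (fun x => cutoff χ R x ^ 2 * h x) Ω) {K : ℝ}
    (hest : ∀ᶠ R : ℝ in atTop, ∀ t : ℝ, 0 < t → ∫ x in Ω, cutoff χ R x ^ 2 * h x ≤
      t * (∫ x in Ω ∩ (Metric.ball 0 R)ᶜ, cutoff χ R x ^ 2 * h x) + t⁻¹ * K) :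
    IntegrableOn h Ω ∧ ∫ x in Ω, h x = 0 := by
  set μ : Measure (EuclideanSpace ℝ (Fin n)) := volume.restrict Ω with hμ
  have hmB : ∀ R : ℝ, MeasurableSet (Metric.ball (0 : EuclideanSpace ℝ (Fin n)) R) := fun R =>
    Metric.isOpen_ball.measurableSet
  have hone : ∀ {R : ℝ}, 1 < R → ∀ x ∈ Metric.ball (0 : EuclideanSpace ℝ (Fin n)) R,
      cutoff χ R x ^ 2 * h x = h x := by
    intro R hR x hx
    rw [cutoff_eq_one hχ (by linarith) (by simpa using (mem_ball_zero_iff.1 hx).le)]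
    ring
  have hIB : ∀ {R : ℝ}, 1 < R → IntegrableOn h (Metric.ball 0 R) μ := fun hR =>
    (Integrable.integrableOn (hint _ hR)).congr_fun (hone hR) (hmB _)
  have hBle : ∀ {R : ℝ}, 1 < R →
      ∫ x in Metric.ball 0 R, h x ∂μ ≤ ∫ x, cutoff χ R x ^ 2 * h x ∂μ := by
    intro R hR
    rw [← setIntegral_congr_fun (hmB R) (hone hR)]
    exact setIntegral_le_integral (hint R hR)
      (ae_of_all _ fun x => mul_nonneg (sq_nonneg _) (h0 x))
  have hcov : AECover μ atTop fun R : ℝ => Metric.ball (0 : EuclideanSpace ℝ (Fin n)) R :=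
    aecover_ball tendsto_id
  have hcompl : ∀ R : ℝ, (volume.restrict (Ω ∩ (Metric.ball 0 R)ᶜ) :
      Measure (EuclideanSpace ℝ (Fin n))) = μ.restrict (Metric.ball 0 R)ᶜ := fun R => by
    rw [hμ, Measure.restrict_restrict (hmB R).compl, Set.inter_comm]
  simp only [hcompl] at hest
  have hbound : ∀ᶠ R : ℝ in atTop, ∫ x in Metric.ball 0 R, h x ∂μ ≤ 4 * K := by
    filter_upwards [hest, eventually_gt_atTop 1] with R hR hR1
    -- With `t = 1/2` half of the left side is absorbed: `I ≤ I/2 + 2K` gives `I ≤ 4K`.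
    have h1 := hR (1 / 2) (by norm_num)
    have h2 : ∫ x in (Metric.ball 0 R)ᶜ, cutoff χ R x ^ 2 * h x ∂μ ≤
        ∫ x, cutoff χ R x ^ 2 * h x ∂μ := setIntegral_le_integral (hint R hR1)
      (ae_of_all _ fun x => mul_nonneg (sq_nonneg _) (h0 x))
    have h3 := hBle hR1
    norm_num at h1
    linarith
  have hI : Integrable h μ := by
    refine hcov.integrable_of_integral_bounded_of_nonneg_ae (4 * K) (fun R => ?_)
      (ae_of_all _ h0) hbound
    -- Integrability is required on every ball, while the hypothesis only covers radii above `1`;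
    -- enlarging to `max R 2` fixes this.
    exact (hIB (lt_max_of_lt_right one_lt_two)).mono_set
      (Metric.ball_subset_ball (le_max_left R 2))
  have hlim := hcov.integral_tendsto_of_countably_generated hI
  refine ⟨hI, le_antisymm ?_ (integral_nonneg h0)⟩
  -- For fixed `t`, let `R → ∞`: the term with factor `t` is at most `25 t` times the tail of a
  -- convergent integral. The `25` is the square of the bound `5` on the cut-off. Only afterwards
  -- may `t` go to infinity.
  have hkey : ∀ t : ℝ, 0 < t → ∫ x, h x ∂μ ≤ t⁻¹ * K := by
    intro t ht
    have h1 : Tendsto (fun R : ℝ => t * (25 * (∫ x, h x ∂μ - ∫ x in Metric.ball 0 R, h x ∂μ)) +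
        t⁻¹ * K) atTop (𝓝 (t * (25 * (∫ x, h x ∂μ - ∫ x, h x ∂μ)) + t⁻¹ * K)) :=
      (((tendsto_const_nhds.sub hlim).const_mul 25).const_mul t).add_const _
    rw [sub_self, mul_zero, mul_zero, zero_add] at h1
    refine le_of_tendsto_of_tendsto hlim h1 ?_
    filter_upwards [hest, eventually_gt_atTop 1] with R hR hR1
    refine (hBle hR1).trans ((hR t ht).trans ?_)
    gcongr
    rw [← integral_add_compl (hmB R) hI, add_sub_cancel_left, ← integral_const_mul]
    refine integral_mono (hint R hR1).integrableOn (hI.integrableOn.const_mul 25) fun x => ?_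
    refine mul_le_mul_of_nonneg_right ?_ (h0 x)
    have h2 := cutoff_le_five hχ (by linarith : 0 < R) x
    have h3 := cutoff_nonneg hχ (by linarith : 0 < R) x
    nlinarith
  have h2 : Tendsto (fun t : ℝ => t⁻¹ * K) atTop (𝓝 (0 * K)) := tendsto_inv_atTop_zero.mul_const K
  rw [zero_mul] at h2
  exact ge_of_tendsto h2 (by filter_upwards [eventually_gt_atTop 0] with t ht using hkey t ht)

/-- If `φ ∇(v/φ)` vanishes in `Ω`, then `v` is a multiple of `φ`. -/
theorem exists_eq_const_mul_of_quotientField_eq_zero (hΩ : IsOpen Ω) (hconn : IsPreconnected Ω)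
    (hv : ContDiffOn ℝ 2 v (closure Ω)) (hφ : ContDiffOn ℝ 2 φ (closure Ω))
    (hpos : ∀ x ∈ closure Ω, 0 < φ x) (hZ : ∀ x ∈ Ω, quotientField Ω v φ x = 0) :
    ∃ C : ℝ, ∀ x ∈ closure Ω, v x = C * φ x := by
  have hda : ∀ {w : EuclideanSpace ℝ (Fin n) → ℝ}, ContDiffOn ℝ 2 w (closure Ω) →
      ∀ x ∈ Ω, DifferentiableAt ℝ w x := fun hw x hx =>
    ((hw x (subset_closure hx)).contDiffAt
      (mem_of_superset (hΩ.mem_nhds hx) subset_closure)).differentiableAt two_ne_zero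
  have hder : ∀ x ∈ Ω, HasFDerivAt (fun y => v y * (φ y)⁻¹) (0 : EuclideanSpace ℝ (Fin n) →L[ℝ] ℝ)
      x := by
    intro x hx
    have hφ0 := (hpos x (subset_closure hx)).ne'
    have h1 := (hda hv x hx).hasFDerivAt.mul
      ((hasDerivAt_inv hφ0).comp_hasFDerivAt x (hda hφ x hx).hasFDerivAt)
    refine h1.congr_fderiv ?_
    -- The derivative of `v/φ` along `w` is `⟨w, Z⟩/φ` with `Z` the quotient field, hence zero.
    ext w
    have h2 := inner_quotientField (Ω := Ω) (v := v) (φ := φ) x w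
    rw [hZ x hx, inner_zero_right, fderivWithin_closure_eq_fderiv hΩ v hx,
      fderivWithin_closure_eq_fderiv hΩ φ hx] at h2
    simp only [Function.comp_apply, add_apply, smul_apply, smul_eq_mul, zero_apply]
    have h3 : fderiv ℝ v x w = v x / φ x * fderiv ℝ φ x w := by linarith
    rw [h3]
    field_simp
    ring
  obtain ⟨C, hC⟩ := hΩ.exists_is_const_of_fderiv_eq_zero hconn
    (fun x hx => (hder x hx).differentiableAt.differentiableWithinAt) fun x hx => (hder x hx).fderiv
  refine ⟨C, Set.EqOn.of_subset_closure (s := Ω) (fun x hx => ?_) hv.continuousOn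
    (continuousOn_const.mul hφ.continuousOn) subset_closure subset_rfl⟩
  have hφ0 := (hpos x (subset_closure hx)).ne'
  have := hC x hx
  field_simp at this
  exact this.trans (mul_comm _ _)

end Liouville

/-! ### The Liouville theorem. -/

theorem mainTheorem9 (n : ℕ) (hn : 1 ≤ n) (Ω : Set (EuclideanSpace ℝ (Fin n)))
    (hΩ : IsRegularDomain Ω) (hgrowth : HasQuadraticGrowth Ω)
    (f : ℝ → ℝ) (hf : ContDiff ℝ 1 f)
    (u : EuclideanSpace ℝ (Fin n) → ℝ) (hu : IsStableSolution Ω f u)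
    (φ : EuclideanSpace ℝ (Fin n) → ℝ) (hφ : IsPrincipalEigenfunction Ω f u φ)
    (χ : ℝ → ℝ) (hχ : IsCutoffProfile χ)
    (v : EuclideanSpace ℝ (Fin n) → ℝ) (hv : IsC2Closure Ω v) (hv_bdd : IsBoundedOn Ω v)
    (hv_ineq : ∀ x ∈ Ω,
      0 ≤ v x * (Laplacian.laplacian v x + deriv f (u x) * v x))
    (hv_boundary : ∀ R : ℝ, 1 < R →
      surfaceIntegral Ω
        (fun x => (cutoff χ R x) ^ 2 * normalDeriv Ω (fun y => (v y) ^ 2) x) ≤ 0) :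
    ∃ C : ℝ, ∀ x ∈ closure Ω, v x = C * φ x := by
  obtain ⟨M, hM⟩ := hv_bdd
  obtain ⟨C, hC, hvol⟩ := hgrowth.exists_volume_le
  have hd := hΩ.uniqueDiffOn_closure
  have hZi := contDiffOn_quotientField hd hv hφ.isC2Closure hφ.pos
  have hZc : ContinuousOn (fun x => ‖quotientField Ω v φ x‖ ^ 2) Ω := by
    simp only [EuclideanSpace.real_norm_sq_eq]
    exact continuousOn_finsetSum _ fun i _ => ((hZi i).continuousOn.mono subset_closure).pow 2
  have hsub : ∀ x ∈ Ω,
      0 ≤ v x * Laplacian.laplacian v x - v x ^ 2 / φ x * Laplacian.laplacian φ x := by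
    intro x hx
    have h1 := hφ.equation x hx
    have hφ0 := hφ.pos x (subset_closure hx)
    have h2 : Laplacian.laplacian φ x =
        -(deriv f (u x) + principalEigenvalue Ω f u) * φ x := by linarith
    -- Stability enters here: eliminating `Δφ` leaves the assumed inequality on `v` plus `λ₁ v²`, so
    -- the sign of `λ₁` decides.
    have h3 : v x * Laplacian.laplacian v x - v x ^ 2 / φ x * Laplacian.laplacian φ x =
        v x * (Laplacian.laplacian v x + deriv f (u x) * v x) +
          principalEigenvalue Ω f u * v x ^ 2 := by
      rw [h2]
      field_simp
      ring
    rw [h3]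
    exact add_nonneg (hv_ineq x hx) (mul_nonneg hu.stable (sq_nonneg _))
  have hcac := fun (R : ℝ) (hR : 1 < R) (t : ℝ) (ht : 0 < t) =>
    hΩ.integral_cutoff_sq_mul_le hn hχ (zero_lt_one.trans hR) hv hφ.isC2Closure hφ.pos hφ.neumann
      hM hsub (hv_boundary R hR) ht
  -- The constant is `(2M/R)² · C (2R)² = 16 M² C`: quadratic volume growth exactly balances the
  -- factor `1/R²`.
  obtain ⟨hI, hI0⟩ := integral_eq_zero_of_cutoff_estimate hχ
    (h := fun x => ‖quotientField Ω v φ x‖ ^ 2) (K := 16 * M ^ 2 * C)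
    (fun x => sq_nonneg _)
    (fun R hR => (hcac R hR 1 one_pos).1) (by
      have h2 : Tendsto (fun R : ℝ => 2 * R) atTop atTop :=
        tendsto_id.const_mul_atTop two_pos
      filter_upwards [h2.eventually hvol, eventually_gt_atTop 1] with R hR hR1 t ht
      refine (hcac R hR1 t ht).2.trans ?_
      refine add_le_add le_rfl (mul_le_mul_of_nonneg_left ?_ (inv_nonneg.2 ht.le))
      have hR0 : 0 < R := by linarith
      calc (2 * M / R) ^ 2 * volume.real (Ω ∩ {x | ‖x‖ ≤ 2 * R})
          ≤ (2 * M / R) ^ 2 * (C * (2 * R) ^ 2) := mul_le_mul_of_nonneg_left hR (sq_nonneg _)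
        _ = 16 * M ^ 2 * C := by
          field_simp
          ring)
  have hae := (integral_eq_zero_iff_of_nonneg (fun x => sq_nonneg ‖quotientField Ω v φ x‖) hI).1 hI0
  -- Continuity of the field upgrades almost everywhere vanishing to vanishing at every point of the
  -- open set.
  have hzero := Measure.eqOn_open_of_ae_eq hae hΩ.isOpen hZc continuousOn_const
  exact exists_eq_const_mul_of_quotientField_eq_zero hΩ.isOpen hΩ.isConnected.isPreconnected hv
    hφ.isC2Closure hφ.pos fun x hx => by simpa using hzero hx
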